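/- Let $n\ge 0$ and $s\ge 1$ be integers and let $(M^{2n+s},f,\xi_\alpha,\eta_\alpha,g)$, $\alpha=1,\dots,s$, be a nonempty compact metric $f$-$K$-contact manifold. That is, $M$ is a smooth closed manifold of dimension $2n+s$ with a smooth $(1,1)$-tensor $f$, smooth vector fields $\xi_1,\dots,\xi_s$, smooth one-forms $\eta_1,\dots,\eta_s$ and a Riemannian metric $g$ such that, for all $\alpha,\beta$ and all tangent vectors $X,Y$, $$\eta_\alpha(\xi_\beta)=\delta_{\alpha\beta},\quad f(\xi_\alpha)=0,\quad \eta_\alpha\circ f=0,\quad f^2=-\mathrm{id}+\sum_{\alpha=1}^s\eta_\alpha\otimes\xi_\alpha,$$ $$g(fX,fY)=g(X,Y)-\sum_{\alpha=1}^s\eta_\alpha(X)\eta_\alpha(Y),\qquad d\eta_\alpha=\omega,\quad\text{where } \omega(X,Y):=g(X,fY),$$ and every $\xi_\alpha$ is a Killing vector field of $g$. Let $\mathcal F$ be the characteristic foliation of $M$, i.e. the foliation whose tangent spaces are spanned by $\xi_1,\dots,\xi_s$, let $\Xi(\mathcal F)$ be the space of smooth vector fields tangent to $\mathcal F$, and let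 $H^*(M,\mathcal F)$ be the basic cohomology of $\mathcal F$, i.e. the cohomology of the subcomplex $$\Omega^*(M,\mathcal F)=\{\sigma\in\Omega^*(M)\mid i_X\sigma=\mathcal L_X\sigma=0 \text{ for all } X\in\Xi(\mathcal F)\}$$ of the de Rham complex $(\Omega^*(M),d)$. Then for every $k=0,\dots,n$ the $k$-fold wedge power $\omega^k$ (with $\omega^0=1$) is a closed form in $\Omega^{2k}(M,\mathcal F)$, and its class in $H^{2k}(M,\mathcal F)$ is nonzero. -/

import Mathlib

open scoped Manifold ContDiff Bundle

noncomputable section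

namespace FKContact

/-! ### Wedge product of alternating forms on a vector space -/

section Wedge

variable {V : Type*} [AddCommGroup V] [Module ℝ V] [TopologicalSpace V]

/-- The tensor product `(a ⊗ b)(v₁, …, v_{p+q}) = a(v₁, …, v_p) b(v_{p+1}, …, v_{p+q})`. -/
def tensor {p q : ℕ} (a : V [⋀^Fin p]→L[ℝ] ℝ) (b : V [⋀^Fin q]→L[ℝ] ℝ) :
    ContinuousMultilinearMap ℝ (fun _ : Fin (p + q) => V) ℝ where
  toMultilinearMap :=
    ((LinearMap.mul' ℝ ℝ).compMultilinearMap
      (MultilinearMap.domCoprod a.toMultilinearMap b.toMultilinearMap)).domDomCongr finSumFinEquiv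
  cont := by
    change Continuous fun v : Fin (p + q) → V =>
      a (fun i => v (Fin.castAdd q i)) * b (fun j => v (Fin.natAdd p j))
    exact (a.cont.comp (continuous_pi fun i => continuous_apply _)).mul
      (b.cont.comp (continuous_pi fun i => continuous_apply _))

theorem tensor_apply {p q : ℕ} (a : V [⋀^Fin p]→L[ℝ] ℝ) (b : V [⋀^Fin q]→L[ℝ] ℝ)
    (v : Fin (p + q) → V) :
    tensor a b v = a (fun i => v (Fin.castAdd q i)) * b (fun j => v (Fin.natAdd p j)) :=
  rfl

/-- The wedge product
`(a ∧ b)(v) = 1/(p! q!) ∑_σ sgn(σ) a(v_{σ(1)}, …, v_{σ(p)}) b(v_{σ(p+1)}, …, v_{σ(p+q)})`. -/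
def wedge {p q : ℕ} (a : V [⋀^Fin p]→L[ℝ] ℝ) (b : V [⋀^Fin q]→L[ℝ] ℝ) :
    V [⋀^Fin (p + q)]→L[ℝ] ℝ :=
  ((p.factorial * q.factorial : ℝ)⁻¹) • ContinuousMultilinearMap.alternatization (tensor a b)

/-- The `k`-th wedge power `a^k = a ∧ ⋯ ∧ a`, with `a^0 = 1`. -/
def wedgePow {p : ℕ} (a : V [⋀^Fin p]→L[ℝ] ℝ) : (k : ℕ) → V [⋀^Fin (p * k)]→L[ℝ] ℝ
  | 0 => ContinuousAlternatingMap.constOfIsEmpty ℝ V (Fin 0) 1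
  | k + 1 => wedge (wedgePow a k) a

end Wedge

/-! ### Differential forms on a manifold without boundary modelled on `E` -/

section Forms

variable {E : Type*} [NormedAddCommGroup E] [NormedSpace ℝ E]
  {M : Type*} [TopologicalSpace M] [ChartedSpace E M]

variable (E M) in
/-- (Not necessarily smooth) differential forms of degree `k` on `M`. -/
def FormField (k : ℕ) : Type _ :=
  ∀ x : M, TangentSpace 𝓘(ℝ, E) x [⋀^Fin k]→L[ℝ] ℝ

instance (k : ℕ) : AddCommGroup (FormField E M k) :=
  inferInstanceAs (AddCommGroup (∀ x : M, TangentSpace 𝓘(ℝ, E) x [⋀^Fin k]→L[ℝ] ℝ))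

instance (k : ℕ) : Module ℝ (FormField E M k) :=
  inferInstanceAs (Module ℝ (∀ x : M, TangentSpace 𝓘(ℝ, E) x [⋀^Fin k]→L[ℝ] ℝ))

@[simp] theorem FormField.add_apply {k : ℕ} (σ τ : FormField E M k) (x : M) :
    (σ + τ) x = σ x + τ x := rfl

@[simp] theorem FormField.smul_apply {k : ℕ} (c : ℝ) (σ : FormField E M k) (x : M) :
    (c • σ) x = c • σ x := rfl

@[simp] theorem FormField.zero_apply {k : ℕ} (x : M) : (0 : FormField E M k) x = 0 := rfl

variable (E M) in
/-- (Not necessarily smooth) vector fields on `M`. -/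
abbrev VField : Type _ := ∀ x : M, TangentSpace 𝓘(ℝ, E) x

/-- Smoothness of a vector field, as a section of the tangent bundle. -/
def IsSmoothVField [IsManifold 𝓘(ℝ, E) ∞ M] (X : VField E M) : Prop :=
  ContMDiff 𝓘(ℝ, E) (𝓘(ℝ, E).prod 𝓘(ℝ, E)) ∞ fun x => Bundle.TotalSpace.mk' E x (X x)

/-- The expression of a form in the chart `φ` at `x₀`, i.e. the pullback `(φ⁻¹)^* σ`, a form on
the open set `φ.target` of `E`. -/
def chartForm {k : ℕ} (σ : FormField E M k) (x₀ : M) : E → E [⋀^Fin k]→L[ℝ] ℝ :=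
  fun y => (σ ((extChartAt 𝓘(ℝ, E) x₀).symm y)).compContinuousLinearMap
    (mfderiv 𝓘(ℝ, E) 𝓘(ℝ, E) (extChartAt 𝓘(ℝ, E) x₀).symm y)

/-- The expression of a vector field in the chart at `x₀`. -/
def chartVField (X : VField E M) (x₀ : M) : E → E :=
  VectorField.mpullback 𝓘(ℝ, E) 𝓘(ℝ, E) (extChartAt 𝓘(ℝ, E) x₀).symm X

/-- A form is smooth if all its expressions in charts are. -/
def IsSmoothForm {k : ℕ} (σ : FormField E M k) : Prop :=
  ∀ x₀ : M, ContDiffOn ℝ ∞ (chartForm σ x₀) (extChartAt 𝓘(ℝ, E) x₀).target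

/-- The exterior derivative, computed at `x` in the chart at `x`:
`dσ(v₀, …, v_k) = ∑ᵢ (-1)^i ∂_{vᵢ} σ(v₀, …, v̂ᵢ, …, v_k)`. -/
def extDer {k : ℕ} (σ : FormField E M k) : FormField E M (k + 1) :=
  fun x => (extDeriv (chartForm σ x) (extChartAt 𝓘(ℝ, E) x x)).compContinuousLinearMap
    (mfderiv 𝓘(ℝ, E) 𝓘(ℝ, E) (extChartAt 𝓘(ℝ, E) x) x)

/-- The Lie derivative of a form on (an open subset of) `E`:
`(L_X σ)_y(v₁, …, v_k) = (∂_X σ)_y(v₁, …, v_k) + ∑ᵢ σ_y(v₁, …, ∂_{vᵢ} X, …, v_k)`. -/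
def lieDerivE {k : ℕ} (X : E → E) (σ : E → E [⋀^Fin k]→L[ℝ] ℝ) (y : E) (v : Fin k → E) : ℝ :=
  fderiv ℝ σ y (X y) v + ∑ i, σ y (Function.update v i (fderiv ℝ X y (v i)))

/-- The Lie derivative `(L_X σ)_x(v₁, …, v_k)` on `M`, computed at `x` in the chart at `x`. -/
def lieDer {k : ℕ} (X : VField E M) (σ : FormField E M k) (x : M)
    (v : Fin k → TangentSpace 𝓘(ℝ, E) x) : ℝ :=
  lieDerivE (chartVField X x) (chartForm σ x) (extChartAt 𝓘(ℝ, E) x x)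
    fun i => mfderiv 𝓘(ℝ, E) 𝓘(ℝ, E) (extChartAt 𝓘(ℝ, E) x) x (v i)

/-- The condition `i_X σ = 0`; it is void for functions. -/
def ContractsToZero (X : VField E M) : {k : ℕ} → FormField E M k → Prop
  | 0, _ => True
  | k + 1, σ => ∀ (x : M) (v : Fin k → TangentSpace 𝓘(ℝ, E) x), σ x (Matrix.vecCons (X x) v) = 0

theorem chartForm_add {k : ℕ} (σ τ : FormField E M k) (x₀ : M) :
    chartForm (σ + τ) x₀ = chartForm σ x₀ + chartForm τ x₀ := rfl

theorem chartForm_smul {k : ℕ} (c : ℝ) (σ : FormField E M k) (x₀ : M) :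
    chartForm (c • σ) x₀ = c • chartForm σ x₀ := rfl

theorem chartForm_zero {k : ℕ} (x₀ : M) : chartForm (0 : FormField E M k) x₀ = 0 := rfl

theorem IsSmoothForm.differentiableAt {k : ℕ} {σ : FormField E M k} (h : IsSmoothForm σ) (x : M) :
    DifferentiableAt ℝ (chartForm σ x) (extChartAt 𝓘(ℝ, E) x x) :=
  ((h x).contDiffAt (extChartAt_target_mem_nhds x)).differentiableAt (by simp)

theorem extDer_add {k : ℕ} {σ τ : FormField E M k} (hσ : IsSmoothForm σ) (hτ : IsSmoothForm τ) :
    extDer (σ + τ) = extDer σ + extDer τ := by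
  funext x
  simp only [extDer, chartForm_add]
  rw [extDeriv_add (hσ.differentiableAt x) (hτ.differentiableAt x)]
  rfl

theorem extDer_smul {k : ℕ} (c : ℝ) (σ : FormField E M k) :
    extDer (c • σ) = c • extDer σ := by
  funext x
  simp only [extDer, chartForm_smul]
  rw [extDeriv_smul]
  rfl

theorem extDer_zero {k : ℕ} : extDer (0 : FormField E M k) = 0 := by
  simpa using extDer_smul (0 : ℝ) (0 : FormField E M k)

theorem lieDer_add {k : ℕ} (X : VField E M) {σ τ : FormField E M k} (hσ : IsSmoothForm σ)
    (hτ : IsSmoothForm τ) (x : M) (v : Fin k → TangentSpace 𝓘(ℝ, E) x) :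
    lieDer X (σ + τ) x v = lieDer X σ x v + lieDer X τ x v := by
  simp only [lieDer, lieDerivE, chartForm_add]
  rw [fderiv_add (hσ.differentiableAt x) (hτ.differentiableAt x)]
  simp only [Pi.add_apply, ContinuousAlternatingMap.add_apply, Finset.sum_add_distrib]
  exact add_add_add_comm _ _ _ _

theorem lieDer_smul {k : ℕ} (X : VField E M) (c : ℝ) {σ : FormField E M k} (hσ : IsSmoothForm σ)
    (x : M) (v : Fin k → TangentSpace 𝓘(ℝ, E) x) :
    lieDer X (c • σ) x v = c * lieDer X σ x v := by
  simp only [lieDer, lieDerivE, chartForm_smul]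
  rw [fderiv_const_smul (hσ.differentiableAt x)]
  simp only [Pi.smul_apply, ContinuousAlternatingMap.smul_apply, smul_eq_mul, mul_add,
    Finset.mul_sum]
  rfl

theorem isSmoothForm_zero {k : ℕ} : IsSmoothForm (0 : FormField E M k) := fun x₀ => by
  rw [chartForm_zero]
  exact contDiffOn_const

theorem lieDer_zero {k : ℕ} (X : VField E M) (x : M) (v : Fin k → TangentSpace 𝓘(ℝ, E) x) :
    lieDer X (0 : FormField E M k) x v = 0 := by
  simpa using lieDer_smul X 0 isSmoothForm_zero x v (σ := (0 : FormField E M k))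

/-! ### Basic forms and basic cohomology

A foliation enters only through its tangent distribution `D`. -/

variable [IsManifold 𝓘(ℝ, E) ∞ M]

/-- `Ξ(𝓕)`: smooth vector fields tangent to the foliation. -/
def tangentVFields (D : ∀ x : M, Submodule ℝ (TangentSpace 𝓘(ℝ, E) x)) : Set (VField E M) :=
  {X | IsSmoothVField X ∧ ∀ x, X x ∈ D x}

/-- `Ω^k(M, 𝓕)`: smooth forms `σ` with `i_X σ = L_X σ = 0` for all `X ∈ Ξ(𝓕)`. -/
def basicForms (D : ∀ x : M, Submodule ℝ (TangentSpace 𝓘(ℝ, E) x)) (k : ℕ) :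
    Submodule ℝ (FormField E M k) where
  carrier := {σ | IsSmoothForm σ ∧ ∀ X ∈ tangentVFields D,
    ContractsToZero X σ ∧ ∀ x v, lieDer X σ x v = 0}
  zero_mem' := by
    refine ⟨isSmoothForm_zero, fun X _ => ⟨?_, fun x v => lieDer_zero X x v⟩⟩
    cases k with
    | zero => trivial
    | succ k => intro x v; rfl
  add_mem' := by
    rintro σ τ ⟨hσ, hσ'⟩ ⟨hτ, hτ'⟩
    refine ⟨fun x₀ => (hσ x₀).add (hτ x₀), fun X hX => ⟨?_, fun x v => ?_⟩⟩
    · cases k with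
      | zero => trivial
      | succ k =>
        intro x v
        have h1 := (hσ' X hX).1 x v
        have h2 := (hτ' X hX).1 x v
        simp [h1, h2]
    · rw [lieDer_add X hσ hτ, (hσ' X hX).2, (hτ' X hX).2, add_zero]
  smul_mem' := by
    rintro c σ ⟨hσ, hσ'⟩
    refine ⟨fun x₀ => (hσ x₀).const_smul c, fun X hX => ⟨?_, fun x v => ?_⟩⟩
    · cases k with
      | zero => trivial
      | succ k =>
        intro x v
        have h1 := (hσ' X hX).1 x v
        simp [h1]
    · rw [lieDer_smul X c hσ, (hσ' X hX).2, mul_zero]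

/-- Closed basic forms. -/
def closedBasicForms (D : ∀ x : M, Submodule ℝ (TangentSpace 𝓘(ℝ, E) x)) (k : ℕ) :
    Submodule ℝ (FormField E M k) where
  carrier := {σ | σ ∈ basicForms D k ∧ extDer σ = 0}
  zero_mem' := ⟨zero_mem _, extDer_zero⟩
  add_mem' := by
    rintro σ τ ⟨hσ, hσ'⟩ ⟨hτ, hτ'⟩
    exact ⟨add_mem hσ hτ, by rw [extDer_add hσ.1 hτ.1, hσ', hτ', add_zero]⟩
  smul_mem' := by
    rintro c σ ⟨hσ, hσ'⟩
    exact ⟨Submodule.smul_mem _ c hσ, by rw [extDer_smul, hσ', smul_zero]⟩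

/-- Exterior derivatives of basic forms of degree `k - 1` (only `0` if `k = 0`). -/
def exactBasicForms (D : ∀ x : M, Submodule ℝ (TangentSpace 𝓘(ℝ, E) x)) :
    (k : ℕ) → Submodule ℝ (FormField E M k)
  | 0 => ⊥
  | k + 1 =>
    { carrier := {σ | ∃ τ ∈ basicForms D k, extDer τ = σ}
      zero_mem' := ⟨0, zero_mem _, extDer_zero⟩
      add_mem' := by
        rintro _ _ ⟨τ, hτ, rfl⟩ ⟨τ', hτ', rfl⟩
        exact ⟨τ + τ', add_mem hτ hτ', extDer_add hτ.1 hτ'.1⟩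
      smul_mem' := by
        rintro c _ ⟨τ, hτ, rfl⟩
        exact ⟨c • τ, Submodule.smul_mem _ c hτ, extDer_smul c τ⟩ }

/-- The basic cohomology `H^k(M, 𝓕)`: closed basic `k`-forms modulo exterior derivatives of basic
`(k-1)`-forms. -/
abbrev BasicCohomology (D : ∀ x : M, Submodule ℝ (TangentSpace 𝓘(ℝ, E) x)) (k : ℕ) : Type _ :=
  closedBasicForms D k ⧸ (exactBasicForms D k).submoduleOf (closedBasicForms D k)

/-- The class in `H^k(M, 𝓕)` of a closed basic form. -/
def basicClass (D : ∀ x : M, Submodule ℝ (TangentSpace 𝓘(ℝ, E) x)) {k : ℕ}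
    (σ : FormField E M k) (hσ : σ ∈ closedBasicForms D k) : BasicCohomology D k :=
  Submodule.Quotient.mk ⟨σ, hσ⟩

end Forms

/-! ### Metric `f`-manifolds -/

section Structures

variable {E : Type*} [NormedAddCommGroup E] [NormedSpace ℝ E]
  {M : Type*} [TopologicalSpace M] [ChartedSpace E M] [IsManifold 𝓘(ℝ, E) ∞ M]

variable (E M) in
/-- The structure tensors `(f, ξ_α, η_α, g)`, `α = 1, …, s`, of a metric `f`-manifold. The relations
imply `f³ + f = 0`, that the `ξ_α` span the kernel of `f`, and hence that `f` has constant rank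
`dim M - s`. -/
structure MetricFStructure (s : ℕ) where
  /-- the `(1,1)`-tensor -/
  f : ∀ x : M, TangentSpace 𝓘(ℝ, E) x →L[ℝ] TangentSpace 𝓘(ℝ, E) x
  /-- the characteristic vector fields -/
  ξ : Fin s → VField E M
  /-- the dual one-forms -/
  η : Fin s → FormField E M 1
  /-- the compatible Riemannian metric -/
  g : Bundle.ContMDiffRiemannianMetric 𝓘(ℝ, E) ∞ E (fun x : M => TangentSpace 𝓘(ℝ, E) x)
  smooth_f : ContMDiff 𝓘(ℝ, E) (𝓘(ℝ, E).prod 𝓘(ℝ, E →L[ℝ] E)) ∞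
    fun x => Bundle.TotalSpace.mk' (E →L[ℝ] E)
      (E := fun x : M => TangentSpace 𝓘(ℝ, E) x →L[ℝ] TangentSpace 𝓘(ℝ, E) x) x (f x)
  smooth_ξ : ∀ α, IsSmoothVField (ξ α)
  smooth_η : ∀ α, IsSmoothForm (η α)
  η_ξ : ∀ α β x, η α x ![ξ β x] = if α = β then 1 else 0
  f_ξ : ∀ α x, f x (ξ α x) = 0
  η_f : ∀ α x v, η α x ![f x v] = 0
  f_sq : ∀ x v, f x (f x v) = -v + ∑ α, η α x ![v] • ξ α x
  compat : ∀ x v w, g.inner x (f x v) (f x w) = g.inner x v w - ∑ α, η α x ![v] * η α x ![w]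

namespace MetricFStructure

variable {s : ℕ} (S : MetricFStructure E M s)

theorem inner_ξ (α : Fin s) (x : M) (v : TangentSpace 𝓘(ℝ, E) x) :
    S.g.inner x v (S.ξ α x) = S.η α x ![v] := by
  have h := S.compat x v (S.ξ α x)
  rw [S.f_ξ, map_zero] at h
  simp only [S.η_ξ, mul_ite, mul_one, mul_zero, Finset.sum_ite_eq', Finset.mem_univ, if_true] at h
  linarith

theorem inner_f_self (x : M) (v : TangentSpace 𝓘(ℝ, E) x) : S.g.inner x v (S.f x v) = 0 := by
  have h := S.compat x v (S.f x v)
  rw [S.f_sq] at h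
  simp only [map_add, map_neg, map_sum, map_smul, S.inner_ξ, S.η_f, smul_zero,
    Finset.sum_const_zero, mul_zero, sub_zero, add_zero] at h
  rw [S.g.symm x (S.f x v) v] at h
  linarith

/-- The fundamental 2-form `ω(X, Y) = g(X, f Y)`. -/
def fundForm : FormField E M 2 := fun x =>
  { toFun := fun v => S.g.inner x (v 0) (S.f x (v 1))
    map_update_add' := by
      intro inst v i a b
      rw [Subsingleton.elim inst (instDecidableEqFin 2)]
      fin_cases i <;> simp
    map_update_smul' := by
      intro inst v i c a
      rw [Subsingleton.elim inst (instDecidableEqFin 2)]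
      fin_cases i <;> simp
    map_eq_zero_of_eq' := by
      intro v i j h hij
      have h01 : v 0 = v 1 := by
        fin_cases i <;> fin_cases j <;> simp_all
      simp only [h01]
      exact S.inner_f_self x (v 1)
    cont := by
      have h1 : Continuous fun v : Fin 2 → E =>
          (show E →L[ℝ] E →L[ℝ] ℝ from S.g.inner x) (v 0)
            ((show E →L[ℝ] E from S.f x) (v 1)) := by
        fun_prop
      exact h1 }

/-- The tangent distribution of the characteristic foliation `𝓕`, spanned by the `ξ_α`. -/
def charDistribution (x : M) : Submodule ℝ (TangentSpace 𝓘(ℝ, E) x) :=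
  Submodule.span ℝ (Set.range fun α => S.ξ α x)

/-- Metric `f`-contact structures: `s > 0` and `dη_α = ω` for all `α`. -/
def IsContact : Prop := 0 < s ∧ ∀ α, extDer (S.η α) = S.fundForm

/-- `X` is a Killing field, `L_X g = 0`:
`X(g(Y, Z)) = g([X, Y], Z) + g(Y, [X, Z])` for all smooth vector fields `Y`, `Z`. -/
def IsKilling (X : VField E M) : Prop :=
  ∀ Y Z : VField E M, IsSmoothVField Y → IsSmoothVField Z → ∀ x,
    (mfderiv 𝓘(ℝ, E) 𝓘(ℝ, ℝ) (fun y => S.g.inner y (Y y) (Z y)) x (X x) : ℝ) =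
      S.g.inner x (VectorField.mlieBracket 𝓘(ℝ, E) X Y x) (Z x) +
        S.g.inner x (Y x) (VectorField.mlieBracket 𝓘(ℝ, E) X Z x)

/-- Metric `f`-`K`-contact structures. -/
def IsKContact : Prop := S.IsContact ∧ ∀ α, S.IsKilling (S.ξ α)

/-- The form `ω^k`, of degree `2k`. -/
def fundFormPow (k : ℕ) : FormField E M (2 * k) := fun x => wedgePow (S.fundForm x) k

end MetricFStructure

end Structures

end FKContact

end

noncomputable section

namespace FKContact

/-! Suppose `ω^k = dτ` with `τ` basic. Since `dω = 0`, the form `τ' = τ ∧ ω^(n-k)` is a basic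
primitive of `ω^n`, and `T = τ' ∧ η_1 ∧ ⋯ ∧ η_s` satisfies `dT = ω^n ∧ η_1 ∧ ⋯ ∧ η_s`: in
`d(β ∧ η_α) = dβ ∧ η_α ± β ∧ ω` the last term vanishes, because it is annihilated by the `ξ`s not
yet used and its degree exceeds the codimension of their span. On the orthogonal complement of
the `ξ`s the form `ω` is nondegenerate, so `dT` has no zeros. It then orients `M`, and
`∫ dT > 0` contradicts Stokes' theorem on the closed manifold `M`. -/

/-! ### Alternating sums over permutations -/

section AltSum

variable {V : Type*} {m p q : ℕ}

/-- Antisymmetrization without normalization: `altSum F v` is the signed sum of `F (v ∘ σ)` over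
all permutations `σ`. It is defined for arbitrary functions `F`, so that it applies both to
products of forms and to their derivatives. -/
def altSum : ((Fin m → V) → ℝ) →ₗ[ℝ] (Fin m → V) → ℝ where
  toFun F v := ∑ σ : Equiv.Perm (Fin m), Equiv.Perm.sign σ • F (v ∘ σ)
  map_add' F G := by
    funext v
    simp only [Pi.add_apply, smul_add, Finset.sum_add_distrib]
  map_smul' c F := by
    funext v
    simp only [Pi.smul_apply, smul_comm _ c, Finset.smul_sum, RingHom.id_apply]

theorem altSum_apply (F : (Fin m → V) → ℝ) (v : Fin m → V) :
    altSum F v = ∑ σ : Equiv.Perm (Fin m), Equiv.Perm.sign σ • F (v ∘ σ) :=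
  rfl

theorem altSum_comp_perm (F : (Fin m → V) → ℝ) (τ : Equiv.Perm (Fin m)) :
    altSum (fun w => F (w ∘ τ)) = Equiv.Perm.sign τ • altSum F := by
  funext v
  rw [Pi.smul_apply, altSum_apply, altSum_apply, Finset.smul_sum,
    ← Equiv.sum_comp (Equiv.mulRight τ⁻¹)]
  refine Finset.sum_congr rfl fun σ _ => ?_
  rw [Function.comp_assoc, ← Equiv.Perm.coe_mul, Equiv.coe_mulRight, inv_mul_cancel_right,
    Equiv.Perm.sign_mul, Equiv.Perm.sign_inv, smul_smul, mul_comm]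

theorem altSum_sum_sign_smul {ι : Type*} [Fintype ι] (F : (Fin m → V) → ℝ)
    (τ : ι → Equiv.Perm (Fin m)) :
    altSum (fun w => ∑ i, Equiv.Perm.sign (τ i) • F (w ∘ τ i)) =
      (Fintype.card ι : ℝ) • altSum F := by
  have h : (fun w => ∑ i, Equiv.Perm.sign (τ i) • F (w ∘ τ i)) =
      ∑ i, ((Equiv.Perm.sign (τ i) : ℤ) : ℝ) • fun w => F (w ∘ τ i) := by
    funext w
    simp only [Finset.sum_apply, Pi.smul_apply, Units.smul_def, zsmul_eq_mul, smul_eq_mul]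
  rw [h, map_sum, Finset.sum_congr rfl fun i _ => ?_, Finset.sum_const, Finset.card_univ,
    Nat.cast_smul_eq_nsmul]
  rw [map_smul, altSum_comp_perm, Int.cast_smul_eq_zsmul, ← Units.smul_def, smul_smul,
    Int.units_mul_self, one_smul]

theorem altSum_comp_cast {m' : ℕ} (h : m = m') (F : (Fin m → V) → ℝ) :
    altSum (fun w : Fin m' → V => F (w ∘ Fin.cast h)) = fun v => altSum F (v ∘ Fin.cast h) := by
  subst h
  rfl

/-- The permutation of `Fin (p + q)` acting by `σ` on the first `p` and by `τ` on the last `q`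
elements. -/
def blockPerm (σ : Equiv.Perm (Fin p)) (τ : Equiv.Perm (Fin q)) : Equiv.Perm (Fin (p + q)) :=
  finSumFinEquiv.permCongr (Equiv.Perm.sumCongr σ τ)

@[simp] theorem sign_blockPerm (σ : Equiv.Perm (Fin p)) (τ : Equiv.Perm (Fin q)) :
    Equiv.Perm.sign (blockPerm σ τ) = Equiv.Perm.sign σ * Equiv.Perm.sign τ := by
  rw [blockPerm, Equiv.Perm.sign_permCongr, Equiv.Perm.sign_sumCongr]

@[simp] theorem comp_blockPerm_castAdd (w : Fin (p + q) → V) (σ : Equiv.Perm (Fin p))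
    (τ : Equiv.Perm (Fin q)) :
    (w ∘ blockPerm σ τ) ∘ Fin.castAdd q = (w ∘ Fin.castAdd q) ∘ σ := by
  funext i
  simp [blockPerm, Equiv.permCongr_apply]

@[simp] theorem comp_blockPerm_natAdd (w : Fin (p + q) → V) (σ : Equiv.Perm (Fin p))
    (τ : Equiv.Perm (Fin q)) :
    (w ∘ blockPerm σ τ) ∘ Fin.natAdd p = (w ∘ Fin.natAdd p) ∘ τ := by
  funext i
  simp [blockPerm, Equiv.permCongr_apply]

theorem blockPerm_injective :
    Function.Injective fun σ : Equiv.Perm (Fin p) × Equiv.Perm (Fin q) => blockPerm σ.1 σ.2 :=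
  finSumFinEquiv.permCongr.injective.comp Equiv.Perm.sumCongrHom_injective

theorem exists_blockPerm_eq {σ : Equiv.Perm (Fin (p + q))}
    (hσ : ∀ i j, σ (Fin.castAdd q i) ≠ Fin.natAdd p j) :
    ∃ (σ₁ : Equiv.Perm (Fin p)) (σ₂ : Equiv.Perm (Fin q)), blockPerm σ₁ σ₂ = σ := by
  have hmem : finSumFinEquiv.permCongr.symm σ ∈
      (Equiv.Perm.sumCongrHom (Fin p) (Fin q)).range := by
    refine Equiv.Perm.mem_sumCongrHom_range_of_perm_mapsTo_inl ?_
    rintro _ ⟨i, rfl⟩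
    have h := hσ i
    simp only [Equiv.permCongr_symm, Equiv.permCongr_apply, Equiv.symm_symm,
      finSumFinEquiv_apply_left]
    generalize σ (Fin.castAdd q i) = y at h ⊢
    induction y using Fin.addCases with
    | left j => exact ⟨j, by simp⟩
    | right j => exact absurd rfl (h j)
  obtain ⟨⟨σ₁, σ₂⟩, h⟩ := hmem
  exact ⟨σ₁, σ₂, (Equiv.symm_apply_eq _).1 h.symm |>.symm⟩

/-- The tensor product of two functions of several vectors. On alternating forms it is `tensor`. -/
def tensorFun :
    ((Fin p → V) → ℝ) →ₗ[ℝ] ((Fin q → V) → ℝ) →ₗ[ℝ] (Fin (p + q) → V) → ℝ :=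
  LinearMap.mk₂ ℝ (fun F G w => F (w ∘ Fin.castAdd q) * G (w ∘ Fin.natAdd p))
    (fun _ _ _ => funext fun _ => add_mul _ _ _) (fun _ _ _ => funext fun _ => mul_assoc _ _ _)
    (fun _ _ _ => funext fun _ => mul_add _ _ _)
    (fun _ _ _ => funext fun _ => mul_left_comm _ _ _)

theorem tensorFun_apply (F : (Fin p → V) → ℝ) (G : (Fin q → V) → ℝ) (w : Fin (p + q) → V) :
    tensorFun F G w = F (w ∘ Fin.castAdd q) * G (w ∘ Fin.natAdd p) :=
  rfl

theorem altSum_tensorFun_altSum_left (F : (Fin p → V) → ℝ) (G : (Fin q → V) → ℝ) :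
    altSum (tensorFun (altSum F) G) = (p.factorial : ℝ) • altSum (tensorFun F G) := by
  have h := altSum_sum_sign_smul (tensorFun F G) fun σ : Equiv.Perm (Fin p) => blockPerm σ 1
  rw [Fintype.card_perm, Fintype.card_fin] at h
  rw [← h]
  congr 1
  funext w
  simp only [tensorFun_apply, altSum_apply, Finset.sum_mul, smul_mul_assoc, sign_blockPerm,
    comp_blockPerm_castAdd, comp_blockPerm_natAdd, Equiv.Perm.sign_one, mul_one,
    Equiv.Perm.coe_one, Function.comp_id]

theorem altSum_tensorFun_altSum_right (F : (Fin p → V) → ℝ) (G : (Fin q → V) → ℝ) :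
    altSum (tensorFun F (altSum G)) = (q.factorial : ℝ) • altSum (tensorFun F G) := by
  have h := altSum_sum_sign_smul (tensorFun F G) fun σ : Equiv.Perm (Fin q) => blockPerm 1 σ
  rw [Fintype.card_perm, Fintype.card_fin] at h
  rw [← h]
  congr 1
  funext w
  simp only [tensorFun_apply, altSum_apply, Finset.mul_sum, mul_smul_comm, sign_blockPerm,
    comp_blockPerm_castAdd, comp_blockPerm_natAdd, Equiv.Perm.sign_one, one_mul,
    Equiv.Perm.coe_one, Function.comp_id]

end AltSum

/-! ### Algebra of the wedge product -/

section WedgeAlgebra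

variable {V : Type*} [AddCommGroup V] [Module ℝ V] [TopologicalSpace V] {p q r : ℕ}

theorem map_comp_perm (a : V [⋀^Fin p]→L[ℝ] ℝ) (v : Fin p → V) (σ : Equiv.Perm (Fin p)) :
    a (v ∘ σ) = Equiv.Perm.sign σ • a v :=
  a.toAlternatingMap.map_perm v σ

theorem altSum_coe (a : V [⋀^Fin p]→L[ℝ] ℝ) : altSum a = (p.factorial : ℝ) • ⇑a := by
  funext v
  simp only [altSum_apply, map_comp_perm, smul_smul, Int.units_mul_self, one_smul,
    Finset.sum_const, Finset.card_univ, Fintype.card_perm, Fintype.card_fin, Pi.smul_apply,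
    Nat.cast_smul_eq_nsmul]

theorem coe_wedge (a : V [⋀^Fin p]→L[ℝ] ℝ) (b : V [⋀^Fin q]→L[ℝ] ℝ) :
    ⇑(wedge a b) = (p.factorial * q.factorial : ℝ)⁻¹ • altSum (tensorFun a b) := by
  funext v
  rw [wedge, ContinuousAlternatingMap.smul_apply,
    ContinuousMultilinearMap.alternatization_apply_apply]
  rfl

theorem wedge_add_left (a a' : V [⋀^Fin p]→L[ℝ] ℝ) (b : V [⋀^Fin q]→L[ℝ] ℝ) :
    wedge (a + a') b = wedge a b + wedge a' b := by
  refine DFunLike.coe_injective ?_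
  simp only [coe_wedge, ContinuousAlternatingMap.coe_add, map_add, LinearMap.add_apply, smul_add]

theorem wedge_add_right (a : V [⋀^Fin p]→L[ℝ] ℝ) (b b' : V [⋀^Fin q]→L[ℝ] ℝ) :
    wedge a (b + b') = wedge a b + wedge a b' := by
  refine DFunLike.coe_injective ?_
  simp only [coe_wedge, ContinuousAlternatingMap.coe_add, map_add, smul_add]

theorem wedge_smul_left (c : ℝ) (a : V [⋀^Fin p]→L[ℝ] ℝ) (b : V [⋀^Fin q]→L[ℝ] ℝ) :
    wedge (c • a) b = c • wedge a b := by
  refine DFunLike.coe_injective ?_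
  simp only [coe_wedge, ContinuousAlternatingMap.coe_smul, map_smul, LinearMap.smul_apply,
    smul_comm _ c]

theorem wedge_smul_right (c : ℝ) (a : V [⋀^Fin p]→L[ℝ] ℝ) (b : V [⋀^Fin q]→L[ℝ] ℝ) :
    wedge a (c • b) = c • wedge a b := by
  refine DFunLike.coe_injective ?_
  simp only [coe_wedge, ContinuousAlternatingMap.coe_smul, map_smul, smul_comm _ c]

@[simp] theorem wedge_zero_left (b : V [⋀^Fin q]→L[ℝ] ℝ) :
    wedge (0 : V [⋀^Fin p]→L[ℝ] ℝ) b = 0 := by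
  simpa using wedge_smul_left (0 : ℝ) (0 : V [⋀^Fin p]→L[ℝ] ℝ) b

@[simp] theorem wedge_zero_right (a : V [⋀^Fin p]→L[ℝ] ℝ) :
    wedge a (0 : V [⋀^Fin q]→L[ℝ] ℝ) = 0 := by
  simpa using wedge_smul_right (0 : ℝ) a (0 : V [⋀^Fin q]→L[ℝ] ℝ)

theorem wedge_compContinuousLinearMap {W : Type*} [AddCommGroup W] [Module ℝ W]
    [TopologicalSpace W] (a : V [⋀^Fin p]→L[ℝ] ℝ) (b : V [⋀^Fin q]→L[ℝ] ℝ) (L : W →L[ℝ] V) :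
    (wedge a b).compContinuousLinearMap L =
      wedge (a.compContinuousLinearMap L) (b.compContinuousLinearMap L) := by
  ext v
  simp only [ContinuousAlternatingMap.compContinuousLinearMap_apply, coe_wedge]
  rfl

theorem wedge_assoc (a : V [⋀^Fin p]→L[ℝ] ℝ) (b : V [⋀^Fin q]→L[ℝ] ℝ) (c : V [⋀^Fin r]→L[ℝ] ℝ)
    (v : Fin (p + q + r) → V) :
    wedge (wedge a b) c v =
      wedge a (wedge b c) (v ∘ Fin.cast (Nat.add_assoc p q r).symm) := by
  have hcast : tensorFun (tensorFun ⇑a ⇑b) ⇑c = fun w : Fin (p + q + r) → V =>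
      tensorFun a (tensorFun b c) (w ∘ Fin.cast (Nat.add_assoc p q r).symm) := by
    funext w
    simp only [tensorFun_apply, mul_assoc]
    congr 3
    exact funext fun i => congrArg w (Fin.ext (by simp [Nat.add_assoc]))
  simp only [coe_wedge, map_smul, LinearMap.smul_apply, Pi.smul_apply, smul_eq_mul,
    altSum_tensorFun_altSum_left, altSum_tensorFun_altSum_right, hcast,
    altSum_comp_cast (Nat.add_assoc p q r).symm]
  field_simp

theorem wedge_comm_two (b c : V [⋀^Fin 2]→L[ℝ] ℝ) : wedge b c = wedge c b := by
  set τ : Equiv.Perm (Fin 4) := Equiv.swap 0 2 * Equiv.swap 1 3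
  have hτ : Equiv.Perm.sign τ = 1 := by decide
  have hbc : tensorFun b c = fun w => tensorFun c b (w ∘ τ) := by
    funext w
    rw [tensorFun_apply, tensorFun_apply, mul_comm]
    congr 2 <;> (funext i; fin_cases i <;> rfl)
  refine DFunLike.coe_injective ?_
  rw [coe_wedge, coe_wedge, hbc, altSum_comp_perm, hτ, one_smul]

theorem wedge_right_comm_two (a : V [⋀^Fin p]→L[ℝ] ℝ) (b c : V [⋀^Fin 2]→L[ℝ] ℝ) :
    wedge (wedge a b) c = wedge (wedge a c) b := by
  ext v
  rw [wedge_assoc, wedge_assoc, wedge_comm_two]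

end WedgeAlgebra

/-! ### The radical of an alternating form -/

section Radical

variable {V : Type*} [AddCommGroup V] [Module ℝ V] [TopologicalSpace V] {p q : ℕ}

/-- The radical of an alternating form `a`: the vectors `x` with `i_x a = 0`. It is everything in
degree `0`. -/
def radical (a : V [⋀^Fin p]→L[ℝ] ℝ) : Submodule ℝ V where
  carrier := {x | ∀ (v : Fin p → V) (i : Fin p), a (Function.update v i x) = 0}
  zero_mem' v i := a.map_coord_zero i (Function.update_self ..)
  add_mem' hx hy v i := by rw [a.map_update_add, hx v i, hy v i, add_zero]
  smul_mem' c x hx v i := by rw [a.map_update_smul, hx v i, smul_zero]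

theorem map_eq_zero_of_mem_radical {a : V [⋀^Fin p]→L[ℝ] ℝ} {v : Fin p → V} {i : Fin p}
    (h : v i ∈ radical a) : a v = 0 := by
  simpa using h v i

theorem mem_radical_of_forall_vecCons {a : V [⋀^Fin (p + 1)]→L[ℝ] ℝ} {x : V}
    (h : ∀ v : Fin p → V, a (Matrix.vecCons x v) = 0) : x ∈ radical a := by
  intro v i
  set w := Function.update v i x with hw
  have hswap : w ∘ Equiv.swap 0 i = Matrix.vecCons x (Fin.tail (w ∘ Equiv.swap 0 i)) := by
    refine (Fin.cons_self_tail _).symm.trans ?_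
    rw [Function.comp_apply, Equiv.swap_apply_left, hw, Function.update_self]
    rfl
  have hperm := map_comp_perm a w (Equiv.swap 0 i)
  rwa [hswap, h, eq_comm, smul_eq_zero_iff_eq] at hperm

theorem inf_radical_le_radical_wedge (a : V [⋀^Fin p]→L[ℝ] ℝ) (b : V [⋀^Fin q]→L[ℝ] ℝ) :
    radical a ⊓ radical b ≤ radical (wedge a b) := by
  rintro x ⟨ha, hb⟩ v i
  rw [coe_wedge, Pi.smul_apply, altSum_apply, Finset.sum_eq_zero, smul_zero]
  intro σ _
  obtain ⟨j, rfl⟩ := σ.surjective i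
  rw [tensorFun_apply]
  induction j using Fin.addCases with
  | left j =>
    rw [map_eq_zero_of_mem_radical (i := j) (by simpa using ha), zero_mul, smul_zero]
  | right j =>
    rw [map_eq_zero_of_mem_radical (i := j) (by simpa using hb), mul_zero, smul_zero]

theorem radical_le_radical_wedgePow (a : V [⋀^Fin p]→L[ℝ] ℝ) (k : ℕ) :
    radical a ≤ radical (wedgePow a k) := by
  induction k with
  | zero => exact fun x _ v i => i.elim0
  | succ k ih => exact (le_inf ih le_rfl).trans (inf_radical_le_radical_wedge _ _)

theorem wedge_append (a : V [⋀^Fin p]→L[ℝ] ℝ) (b : V [⋀^Fin q]→L[ℝ] ℝ) (v : Fin p → V)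
    {w : Fin q → V} (hw : ∀ j, w j ∈ radical a) : wedge a b (Fin.append v w) = a v * b w := by
  have hblock (σ : Equiv.Perm (Fin p) × Equiv.Perm (Fin q)) :
      a v * b w = Equiv.Perm.sign (blockPerm σ.1 σ.2) •
        tensorFun a b (Fin.append v w ∘ blockPerm σ.1 σ.2) := by
    have hl : Fin.append v w ∘ Fin.castAdd q = v := funext (Fin.append_left v w)
    have hr : Fin.append v w ∘ Fin.natAdd p = w := funext (Fin.append_right v w)
    rw [tensorFun_apply, comp_blockPerm_castAdd, comp_blockPerm_natAdd, hl, hr, map_comp_perm,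
      map_comp_perm, smul_mul_smul_comm, smul_smul, sign_blockPerm, Int.units_mul_self, one_smul]
  have hother (σ : Equiv.Perm (Fin (p + q)))
      (hσ : σ ∉ Set.range fun σ : Equiv.Perm (Fin p) × Equiv.Perm (Fin q) =>
        blockPerm σ.1 σ.2) :
      Equiv.Perm.sign σ • tensorFun a b (Fin.append v w ∘ σ) = 0 := by
    obtain ⟨i, j, hij⟩ : ∃ i j, σ (Fin.castAdd q i) = Fin.natAdd p j := by
      by_contra! h
      obtain ⟨σ₁, σ₂, h⟩ := exists_blockPerm_eq h
      exact hσ ⟨(σ₁, σ₂), h⟩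
    rw [tensorFun_apply, map_eq_zero_of_mem_radical (i := i) (by simpa [hij] using hw j),
      zero_mul, smul_zero]
  have hsum : altSum (tensorFun a b) (Fin.append v w) =
      ∑ _σ : Equiv.Perm (Fin p) × Equiv.Perm (Fin q), a v * b w :=
    (Finset.sum_of_injOn _ blockPerm_injective.injOn (fun _ _ => Finset.mem_univ _)
      (fun σ _ hσ => hother σ (by simpa using hσ)) (fun σ _ => hblock σ)).symm
  rw [coe_wedge, Pi.smul_apply, hsum, Finset.sum_const, Finset.card_univ, Fintype.card_prod,
    Fintype.card_perm, Fintype.card_perm, Fintype.card_fin, Fintype.card_fin, nsmul_eq_mul,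
    smul_eq_mul]
  push_cast
  field_simp

theorem eq_zero_of_finrank_lt [FiniteDimensional ℝ V] {a : V [⋀^Fin p]→L[ℝ] ℝ}
    (h : Module.finrank ℝ V < p + Module.finrank ℝ (radical a)) : a = 0 := by
  ext v
  have hdep : ¬ LinearIndependent ℝ fun i => (radical a).mkQ (v i) := fun hli => by
    have hcard := hli.fintype_card_le_finrank
    have hquot := (radical a).finrank_quotient_add_finrank
    rw [Fintype.card_fin] at hcard
    omega
  obtain ⟨c, hc, i, hi⟩ := Fintype.not_linearIndependent_iff.1 hdep
  have hmem : ∑ j, c j • v j ∈ radical a := by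
    rw [← Submodule.Quotient.mk_eq_zero, ← Submodule.mkQ_apply, map_sum]
    simpa only [map_smul] using hc
  have hsum : a (Function.update v i (∑ j, c j • v j)) = c i • a v := by
    refine (a.toAlternatingMap.map_update_sum Finset.univ i (fun j => c j • v j) v).trans ?_
    rw [Finset.sum_eq_single i, AlternatingMap.map_update_smul, Function.update_eq_self]
    · rfl
    · intro j _ hj
      rw [AlternatingMap.map_update_smul, AlternatingMap.map_update_self _ _ hj.symm, smul_zero]
    · exact fun hi => absurd (Finset.mem_univ i) hi
  have hzero : c i • a v = 0 := hsum.symm.trans (hmem v i)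
  exact (smul_eq_zero.1 hzero).resolve_left hi

end Radical

/-! ### Powers of two-forms -/

section TwoForms

variable {V : Type*} [AddCommGroup V] [Module ℝ V] [TopologicalSpace V] {p : ℕ}

theorem map_pair_swap (b : V [⋀^Fin 2]→L[ℝ] ℝ) (x y : V) : b ![x, y] = -b ![y, x] := by
  have hswap : ![y, x] ∘ Equiv.swap (0 : Fin 2) 1 = ![x, y] := by
    funext i
    fin_cases i <;> rfl
  rw [← hswap]
  exact b.toAlternatingMap.map_swap ![y, x] zero_ne_one

theorem map_pair_self (b : V [⋀^Fin 2]→L[ℝ] ℝ) (x : V) : b ![x, x] = 0 :=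
  b.map_eq_zero_of_eq ![x, x] (i := 0) (j := 1) rfl zero_ne_one

/-- The contraction `i_x b = b(x, ·)` of a two-form. -/
def pairing (b : V [⋀^Fin 2]→L[ℝ] ℝ) (x : V) : V →L[ℝ] ℝ :=
  b.toContinuousMultilinearMap.toContinuousLinearMap ![x, 0] 1

theorem pairing_apply (b : V [⋀^Fin 2]→L[ℝ] ℝ) (x y : V) : pairing b x y = b ![x, y] := by
  refine congrArg b (funext fun i => ?_)
  fin_cases i <;> rfl

/-- The contraction `i_x b = b(x, ·)` of a two-form, as a one-form. -/
def contract (b : V [⋀^Fin 2]→L[ℝ] ℝ) (x : V) : V [⋀^Fin 1]→L[ℝ] ℝ :=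
  ContinuousAlternatingMap.ofSubsingleton ℝ V ℝ 0 (pairing b x)

theorem contract_apply (b : V [⋀^Fin 2]→L[ℝ] ℝ) (x y : V) : contract b x ![y] = b ![x, y] :=
  pairing_apply b x y

theorem mem_radical_two_iff {b : V [⋀^Fin 2]→L[ℝ] ℝ} {x : V} :
    x ∈ radical b ↔ ∀ y, b ![x, y] = 0 := by
  refine ⟨fun h y => map_eq_zero_of_mem_radical (i := 0) h,
    fun h => mem_radical_of_forall_vecCons fun v => ?_⟩
  rw [← h (v 0)]
  congr 1
  funext i
  fin_cases i <;> rfl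

theorem wedge_one_one_apply (α β : V [⋀^Fin 1]→L[ℝ] ℝ) (x y : V) :
    wedge α β ![x, y] = α ![x] * β ![y] - α ![y] * β ![x] := by
  have huniv : (Finset.univ : Finset (Equiv.Perm (Fin 2))) = {1, Equiv.swap 0 1} := by decide
  have htensor (v : Fin 2 → V) : tensorFun α β v = α ![v 0] * β ![v 1] := by
    rw [tensorFun_apply]
    congr 2 <;> (funext i; fin_cases i; rfl)
  rw [coe_wedge, Pi.smul_apply, altSum_apply, huniv, Finset.sum_pair (by decide), htensor, htensor]
  simp [sub_eq_add_neg]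

theorem wedge_comm_one (α β : V [⋀^Fin 1]→L[ℝ] ℝ) : wedge α β = -wedge β α := by
  have hαβ : tensorFun α β = fun w => tensorFun β α (w ∘ Equiv.swap (0 : Fin 2) 1) := by
    funext w
    rw [tensorFun_apply, tensorFun_apply, mul_comm]
    congr 2 <;> (funext i; fin_cases i; rfl)
  refine DFunLike.coe_injective ?_
  rw [ContinuousAlternatingMap.coe_neg, coe_wedge, coe_wedge, hαβ, altSum_comp_perm,
    Equiv.Perm.sign_swap zero_ne_one, Units.neg_smul, one_smul, smul_neg]

theorem wedge_self_one (α : V [⋀^Fin 1]→L[ℝ] ℝ) : wedge α α = 0 := by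
  ext v
  exact self_eq_neg.1 (DFunLike.congr_fun (wedge_comm_one α α) v)

theorem wedge_right_comm_one (a : V [⋀^Fin p]→L[ℝ] ℝ) (β γ : V [⋀^Fin 1]→L[ℝ] ℝ) :
    wedge (wedge a β) γ = -wedge (wedge a γ) β := by
  ext v
  rw [ContinuousAlternatingMap.neg_apply, wedge_assoc, wedge_assoc, wedge_comm_one,
    ← neg_one_smul ℝ, wedge_smul_right, ContinuousAlternatingMap.smul_apply, neg_one_smul]

theorem wedge_wedge_self_left_one (α β : V [⋀^Fin 1]→L[ℝ] ℝ) : wedge (wedge α β) α = 0 := by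
  refine (wedge_right_comm_one α β α).trans ?_
  simp only [wedge_self_one, wedge_zero_left, neg_zero]

theorem wedge_wedge_eq_zero_of_wedge_eq_zero (a : V [⋀^Fin p]→L[ℝ] ℝ) {β : V [⋀^Fin 1]→L[ℝ] ℝ}
    (h : wedge a β = 0) (γ : V [⋀^Fin 1]→L[ℝ] ℝ) : wedge a (wedge β γ) = 0 := by
  ext v
  have hassoc := wedge_assoc a β γ v
  rw [h, wedge_zero_left] at hassoc
  exact hassoc.symm

theorem wedge_self_wedge_one_one (α β : V [⋀^Fin 1]→L[ℝ] ℝ) :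
    wedge (wedge α β) (wedge α β) = 0 :=
  wedge_wedge_eq_zero_of_wedge_eq_zero _ (wedge_wedge_self_left_one α β) β

theorem wedgePow_add_of_wedge_self_eq_zero (b : V [⋀^Fin 2]→L[ℝ] ℝ) {c : V [⋀^Fin 2]→L[ℝ] ℝ}
    (hc : wedge c c = 0) (k : ℕ) :
    wedgePow (b + c) (k + 1) = wedgePow b (k + 1) + (k + 1 : ℝ) • wedge (wedgePow b k) c := by
  induction k with
  | zero =>
    rw [CharP.cast_eq_zero, zero_add (1 : ℝ), one_smul]
    exact wedge_add_right _ b c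
  | succ k ih =>
    have hcc : wedge (wedge (wedgePow b k) c) c = 0 := by
      ext v
      rw [wedge_assoc, hc, wedge_zero_right]
      rfl
    have hexpand : wedge (wedge (wedgePow b k) b + (k + 1 : ℝ) • wedge (wedgePow b k) c) (b + c) =
        wedge (wedge (wedgePow b k) b) b +
          ((k + 1 : ℕ) + 1 : ℝ) • wedge (wedge (wedgePow b k) b) c := by
      rw [wedge_add_right, wedge_add_left, wedge_add_left, wedge_smul_left, wedge_smul_left, hcc,
        wedge_right_comm_two _ c b]
      push_cast
      module
    exact (congrArg (wedge · (b + c)) ih).trans hexpand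

/-- The rank two part of a two-form `b` on the span of `w` and `u`, namely `i_w b ∧ i_u b`. If
`b(w, u) = 1` it agrees with `b` on this plane and has the same contractions by `w` and `u`. -/
def planePart (b : V [⋀^Fin 2]→L[ℝ] ℝ) (w u : V) : V [⋀^Fin 2]→L[ℝ] ℝ :=
  wedge (contract b w) (contract b u)

theorem planePart_apply (b : V [⋀^Fin 2]→L[ℝ] ℝ) (w u x y : V) :
    planePart b w u ![x, y] = b ![w, x] * b ![u, y] - b ![w, y] * b ![u, x] := by
  rw [planePart, wedge_one_one_apply, contract_apply, contract_apply, contract_apply,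
    contract_apply]

theorem left_mem_radical_sub_planePart {b : V [⋀^Fin 2]→L[ℝ] ℝ} {w u : V} (h : b ![w, u] = 1) :
    w ∈ radical (b - planePart b w u) := by
  refine mem_radical_two_iff.2 fun y => ?_
  rw [ContinuousAlternatingMap.sub_apply, planePart_apply, map_pair_self, map_pair_swap b u w, h]
  ring

theorem right_mem_radical_sub_planePart {b : V [⋀^Fin 2]→L[ℝ] ℝ} {w u : V} (h : b ![w, u] = 1) :
    u ∈ radical (b - planePart b w u) := by
  refine mem_radical_two_iff.2 fun y => ?_
  rw [ContinuousAlternatingMap.sub_apply, planePart_apply, map_pair_self b u, h]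
  ring

theorem radical_sub_planePart_le (b : V [⋀^Fin 2]→L[ℝ] ℝ) (w u : V) :
    radical (b - planePart b w u) ≤ radical b ⊔ Submodule.span ℝ {w, u} := by
  intro x hx
  have hdiff : x - (b ![w, x] • u - b ![u, x] • w) ∈ radical b := by
    refine mem_radical_two_iff.2 fun y => ?_
    have hxy := mem_radical_two_iff.1 hx y
    rw [ContinuousAlternatingMap.sub_apply, planePart_apply] at hxy
    rw [map_pair_swap, ← pairing_apply, map_sub, map_sub, map_smul, map_smul]
    simp only [pairing_apply, smul_eq_mul, map_pair_swap b y]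
    linear_combination hxy
  have hplane : b ![w, x] • u - b ![u, x] • w ∈ Submodule.span ℝ {w, u} :=
    sub_mem (Submodule.smul_mem _ _ (Submodule.subset_span (by simp)))
      (Submodule.smul_mem _ _ (Submodule.subset_span (by simp)))
  simpa using Submodule.add_mem_sup hdiff hplane

theorem finrank_radical_sub_planePart_le [FiniteDimensional ℝ V] (b : V [⋀^Fin 2]→L[ℝ] ℝ)
    (w u : V) :
    Module.finrank ℝ (radical (b - planePart b w u)) ≤ Module.finrank ℝ (radical b) + 2 := by
  classical
  have hspan : Module.finrank ℝ (Submodule.span ℝ {w, u}) ≤ 2 := by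
    have h := finrank_span_finset_le_card (R := ℝ) ({w, u} : Finset V)
    rw [Finset.coe_pair] at h
    exact h.trans Finset.card_le_two
  calc Module.finrank ℝ (radical (b - planePart b w u))
      ≤ Module.finrank ℝ ↥(radical b ⊔ Submodule.span ℝ {w, u}) :=
        Submodule.finrank_mono (radical_sub_planePart_le b w u)
    _ ≤ Module.finrank ℝ (radical b) + Module.finrank ℝ (Submodule.span ℝ {w, u}) :=
        Submodule.finrank_add_le_finrank_add_finrank _ _
    _ ≤ Module.finrank ℝ (radical b) + 2 := by gcongr

theorem exists_map_pair_eq_one {b : V [⋀^Fin 2]→L[ℝ] ℝ} (h : radical b ≠ ⊤) :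
    ∃ w u, b ![w, u] = 1 := by
  obtain ⟨w, hw⟩ : ∃ w, w ∉ radical b := by
    by_contra! hall
    exact h (eq_top_iff.2 fun x _ => hall x)
  obtain ⟨u, hu⟩ : ∃ u, b ![w, u] ≠ 0 := by
    simpa only [mem_radical_two_iff, not_forall] using hw
  refine ⟨w, (b ![w, u])⁻¹ • u, ?_⟩
  rw [← pairing_apply, map_smul, pairing_apply, smul_eq_mul, inv_mul_cancel₀ hu]

theorem wedgePow_add_append {b c : V [⋀^Fin 2]→L[ℝ] ℝ} {w u : V} (hc : wedge c c = 0)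
    (hw : w ∈ radical b) (hu : u ∈ radical b) (n : ℕ) (v : Fin (2 * n) → V) :
    wedgePow (b + c) (n + 1) (Fin.append v ![w, u]) =
      (n + 1) * (wedgePow b n v * c ![w, u]) := by
  have hb : wedgePow b (n + 1) (Fin.append v ![w, u]) = 0 :=
    map_eq_zero_of_mem_radical (i := Fin.natAdd (2 * n) 0)
      (radical_le_radical_wedgePow _ _ (by simpa using hw))
  have hbc : wedge (wedgePow b n) c (Fin.append v ![w, u]) = wedgePow b n v * c ![w, u] := by
    refine wedge_append _ _ _ fun j => radical_le_radical_wedgePow _ _ ?_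
    fin_cases j
    exacts [hw, hu]
  rw [wedgePow_add_of_wedge_self_eq_zero b hc, ContinuousAlternatingMap.add_apply,
    ContinuousAlternatingMap.smul_apply, hb, zero_add, smul_eq_mul]
  exact congrArg _ hbc

theorem wedgePow_ne_zero [FiniteDimensional ℝ V] {n : ℕ} {b : V [⋀^Fin 2]→L[ℝ] ℝ}
    (h : 2 * n + Module.finrank ℝ (radical b) ≤ Module.finrank ℝ V) : wedgePow b n ≠ 0 := by
  induction n generalizing b with
  | zero => exact fun h0 => one_ne_zero (DFunLike.congr_fun h0 Fin.elim0)
  | succ n ih =>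
    obtain ⟨w, u, hwu⟩ : ∃ w u, b ![w, u] = 1 := by
      refine exists_map_pair_eq_one fun htop => ?_
      rw [htop, finrank_top] at h
      omega
    have hrank := finrank_radical_sub_planePart_le b w u
    refine fun h0 => ih (b := b - planePart b w u) (by omega) (ContinuousAlternatingMap.ext ?_)
    intro v
    have happend := wedgePow_add_append (c := planePart b w u) (wedge_self_wedge_one_one _ _)
      (left_mem_radical_sub_planePart hwu) (right_mem_radical_sub_planePart hwu) n v
    have hplane : planePart b w u ![w, u] = 1 := by
      rw [planePart_apply, map_pair_self, map_pair_swap b u w, hwu]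
      ring
    rw [sub_add_cancel, h0, hplane, mul_one] at happend
    exact (mul_eq_zero.1 happend.symm).resolve_left n.cast_add_one_ne_zero

end TwoForms

/-! ### The Leibniz rule on a normed space -/

section AltSumUncurry

variable {V : Type*} {m p q : ℕ}

/-- Uncurrying of a function whose value depends on a first vector and on `m` further ones. -/
def uncurryFun (G : V → (Fin m → V) → ℝ) (w : Fin (m + 1) → V) : ℝ :=
  G (w 0) (Fin.tail w)

theorem altSum_uncurryFun_altSum (G : V → (Fin m → V) → ℝ) :
    altSum (uncurryFun fun x => altSum (G x)) = (m.factorial : ℝ) • altSum (uncurryFun G) := by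
  have h := altSum_sum_sign_smul (uncurryFun G) fun σ : Equiv.Perm (Fin m) =>
    Equiv.Perm.decomposeFin.symm (0, σ)
  rw [Fintype.card_perm, Fintype.card_fin] at h
  rw [← h]
  congr 1
  funext w
  refine Finset.sum_congr rfl fun σ _ => ?_
  have htail : Fin.tail (w ∘ Equiv.Perm.decomposeFin.symm (0, σ)) = Fin.tail w ∘ σ := by
    funext i
    simp [Fin.tail]
  simp [uncurryFun, htail, Equiv.Perm.decomposeFin.symm_sign]

theorem tensorFun_uncurryFun_left (G : V → (Fin p → V) → ℝ) (b : (Fin q → V) → ℝ) :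
    tensorFun (uncurryFun G) b = fun w =>
      uncurryFun (fun x => tensorFun (G x) b) (w ∘ Fin.cast (Nat.add_right_comm p q 1)) := by
  funext w
  simp only [tensorFun_apply, uncurryFun]
  congr 2
  funext j
  exact congrArg w (Fin.ext (by simp [Nat.add_right_comm]))

theorem tensorFun_uncurryFun_right (a : (Fin p → V) → ℝ) (G : V → (Fin q → V) → ℝ) :
    tensorFun a (uncurryFun G) = fun w : Fin (p + q + 1) → V =>
      uncurryFun (fun x => tensorFun a (G x))
        (w ∘ (Fin.natAdd p (0 : Fin (q + 1))).cycleRange.symm) := by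
  funext w
  set i₀ : Fin (p + q + 1) := Fin.natAdd p (0 : Fin (q + 1))
  have hhead : (w ∘ i₀.cycleRange.symm) 0 = (w ∘ Fin.natAdd p : Fin (q + 1) → V) 0 := by
    rw [Function.comp_apply, Fin.cycleRange_symm_zero, Function.comp_apply]
  have hfirst : Fin.tail (w ∘ i₀.cycleRange.symm) ∘ Fin.castAdd q = w ∘ Fin.castAdd (q + 1) := by
    funext j
    simp only [Function.comp_apply, Fin.tail, Fin.cycleRange_symm_succ]
    rw [Fin.succAbove_of_castSucc_lt _ _ (by simp [Fin.lt_def, i₀])]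
    rfl
  have hlast : Fin.tail (w ∘ i₀.cycleRange.symm) ∘ Fin.natAdd p =
      Fin.tail (w ∘ Fin.natAdd p : Fin (q + 1) → V) := by
    funext j
    simp only [Function.comp_apply, Fin.tail, Fin.cycleRange_symm_succ]
    rw [Fin.succAbove_of_le_castSucc _ _ (by simp [Fin.le_def, i₀])]
    rfl
  simp only [tensorFun_apply, uncurryFun, hhead, hfirst, hlast]

end AltSumUncurry

section Leibniz

variable {E : Type*} [NormedAddCommGroup E] [NormedSpace ℝ E] {p q : ℕ}

open ContinuousAlternatingMap (alternatizeUncurryFin)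

theorem coe_alternatizeUncurryFin (A : E →L[ℝ] E [⋀^Fin p]→L[ℝ] ℝ) :
    ⇑(alternatizeUncurryFin A) = (p.factorial : ℝ)⁻¹ • altSum (uncurryFun fun x => A x) := by
  have hcycle : ⇑(alternatizeUncurryFin A) = fun w => ∑ i : Fin (p + 1),
      Equiv.Perm.sign i.cycleRange.symm • uncurryFun (fun x => A x) (w ∘ i.cycleRange.symm) := by
    funext w
    rw [ContinuousAlternatingMap.alternatizeUncurryFin_apply]
    refine Finset.sum_congr rfl fun i _ => ?_
    have htail : Fin.tail (w ∘ i.cycleRange.symm) = i.removeNth w := by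
      funext j
      simp [Fin.tail, Fin.removeNth]
    rw [uncurryFun, htail, Equiv.Perm.sign_symm, Fin.sign_cycleRange, Function.comp_apply,
      Fin.cycleRange_symm_zero, Units.smul_def]
    simp
  have h := altSum_coe (alternatizeUncurryFin A)
  rw [hcycle, altSum_sum_sign_smul, Fintype.card_fin, ← hcycle, Nat.factorial_succ, Nat.cast_mul,
    mul_smul] at h
  rw [smul_right_injective _ (Nat.cast_ne_zero.2 p.succ_ne_zero : ((p + 1 : ℕ) : ℝ) ≠ 0) h,
    inv_smul_smul₀ (Nat.cast_ne_zero.2 p.factorial_ne_zero)]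

theorem norm_wedge_apply_le (a : E [⋀^Fin p]→L[ℝ] ℝ) (b : E [⋀^Fin q]→L[ℝ] ℝ)
    (v : Fin (p + q) → E) :
    ‖wedge a b v‖ ≤ ((p.factorial * q.factorial : ℝ)⁻¹ * (p + q).factorial * ‖a‖ * ‖b‖) *
      ∏ i, ‖v i‖ := by
  have hterm (σ : Equiv.Perm (Fin (p + q))) :
      ‖Equiv.Perm.sign σ • tensorFun a b (v ∘ σ)‖ ≤ ‖a‖ * ‖b‖ * ∏ i, ‖v i‖ := by
    calc _ = ‖a ((v ∘ σ) ∘ Fin.castAdd q)‖ * ‖b ((v ∘ σ) ∘ Fin.natAdd p)‖ := by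
          rcases Int.units_eq_one_or (Equiv.Perm.sign σ) with h | h <;> simp [h, tensorFun_apply]
      _ ≤ (‖a‖ * ∏ i, ‖v (σ (Fin.castAdd q i))‖) * (‖b‖ * ∏ i, ‖v (σ (Fin.natAdd p i))‖) :=
          mul_le_mul (a.le_opNorm _) (b.le_opNorm _) (norm_nonneg _) (by positivity)
      _ = ‖a‖ * ‖b‖ * ∏ i, ‖v i‖ := by
          rw [← Equiv.prod_comp σ fun i => ‖v i‖, Fin.prod_univ_add]
          ring
  rw [coe_wedge, Pi.smul_apply, norm_smul, Real.norm_of_nonneg (by positivity), altSum_apply]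
  calc _ ≤ (p.factorial * q.factorial : ℝ)⁻¹ *
        ∑ _σ : Equiv.Perm (Fin (p + q)), ‖a‖ * ‖b‖ * ∏ i, ‖v i‖ := by
        gcongr
        exact norm_sum_le_of_le _ fun σ _ => hterm σ
    _ = _ := by
        rw [Finset.sum_const, Finset.card_univ, Fintype.card_perm, Fintype.card_fin, nsmul_eq_mul]
        ring

variable (E p q) in
/-- The wedge product as a continuous bilinear map. -/
def wedgeL : (E [⋀^Fin p]→L[ℝ] ℝ) →L[ℝ] (E [⋀^Fin q]→L[ℝ] ℝ) →L[ℝ] (E [⋀^Fin (p + q)]→L[ℝ] ℝ) :=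
  LinearMap.mkContinuous₂
    (LinearMap.mk₂ ℝ wedge wedge_add_left wedge_smul_left wedge_add_right wedge_smul_right)
    ((p.factorial * q.factorial : ℝ)⁻¹ * (p + q).factorial)
    fun a b => ContinuousAlternatingMap.opNorm_le_bound _ (by positivity)
      (norm_wedge_apply_le a b)

theorem coe_alternatizeUncurryFin_of_eq_smul_altSum {A : E →L[ℝ] E [⋀^Fin p]→L[ℝ] ℝ} {c : ℝ}
    {G : E → (Fin p → E) → ℝ} (h : ∀ x, ⇑(A x) = c • altSum (G x)) :
    ⇑(alternatizeUncurryFin A) = c • altSum (uncurryFun G) := by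
  have hsmul : uncurryFun (fun x => ⇑(A x)) = c • uncurryFun fun x => altSum (G x) := by
    simp only [h]
    rfl
  rw [coe_alternatizeUncurryFin, hsmul, map_smul, altSum_uncurryFun_altSum, smul_comm c,
    inv_smul_smul₀ (Nat.cast_ne_zero.2 p.factorial_ne_zero)]

theorem alternatizeUncurryFin_wedge_left (A : E →L[ℝ] E [⋀^Fin p]→L[ℝ] ℝ)
    (b : E [⋀^Fin q]→L[ℝ] ℝ) (v : Fin (p + q + 1) → E) :
    alternatizeUncurryFin ((wedgeL E p q).precompL E A b) v =
      wedge (alternatizeUncurryFin A) b (v ∘ Fin.cast (Nat.add_right_comm p 1 q)) := by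
  have hleft := coe_alternatizeUncurryFin_of_eq_smul_altSum
    (A := (wedgeL E p q).precompL E A b) fun x => coe_wedge (A x) b
  rw [hleft, coe_wedge, coe_alternatizeUncurryFin, map_smul, LinearMap.smul_apply, map_smul,
    altSum_tensorFun_altSum_left, tensorFun_uncurryFun_left,
    altSum_comp_cast (Nat.add_right_comm p q 1)]
  simp only [Pi.smul_apply, smul_eq_mul]
  have hv : (v ∘ Fin.cast (Nat.add_right_comm p 1 q)) ∘ Fin.cast (Nat.add_right_comm p q 1) = v :=
    rfl
  rw [hv]
  have := Nat.cast_ne_zero (R := ℝ).2 p.factorial_ne_zero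
  have := Nat.cast_ne_zero (R := ℝ).2 (p + 1).factorial_ne_zero
  field_simp

theorem alternatizeUncurryFin_wedge_right (a : E [⋀^Fin p]→L[ℝ] ℝ)
    (B : E →L[ℝ] E [⋀^Fin q]→L[ℝ] ℝ) (v : Fin (p + q + 1) → E) :
    alternatizeUncurryFin ((wedgeL E p q).precompR E a B) v =
      (-1) ^ p * wedge a (alternatizeUncurryFin B) v := by
  have hleft := coe_alternatizeUncurryFin_of_eq_smul_altSum
    (A := (wedgeL E p q).precompR E a B) fun x => coe_wedge a (B x)
  have hsign : Equiv.Perm.sign (Fin.natAdd p (0 : Fin (q + 1))).cycleRange.symm = (-1) ^ p := by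
    rw [Equiv.Perm.sign_symm, Fin.sign_cycleRange]
    simp
  have hright : altSum (tensorFun a (uncurryFun fun x => B x)) =
      (-1 : ℝ) ^ p • altSum (uncurryFun fun x => tensorFun a (B x)) := by
    rw [tensorFun_uncurryFun_right]
    refine (altSum_comp_perm _ _).trans ?_
    rw [hsign, Units.smul_def, ← Int.cast_smul_eq_zsmul ℝ]
    norm_num
  rw [hleft, coe_wedge, coe_alternatizeUncurryFin, map_smul, map_smul,
    altSum_tensorFun_altSum_right, hright]
  simp only [Pi.smul_apply, smul_eq_mul]
  have := Nat.cast_ne_zero (R := ℝ).2 q.factorial_ne_zero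
  have := Nat.cast_ne_zero (R := ℝ).2 (q + 1).factorial_ne_zero
  have hpow : ((-1 : ℝ) ^ p) ^ 2 = 1 := by rw [← pow_mul, pow_mul', neg_one_sq, one_pow]
  field_simp
  rw [hpow, mul_one]

theorem extDeriv_wedge_apply {a : E → E [⋀^Fin p]→L[ℝ] ℝ} {b : E → E [⋀^Fin q]→L[ℝ] ℝ} {y : E}
    (ha : DifferentiableAt ℝ a y) (hb : DifferentiableAt ℝ b y) (v : Fin (p + q + 1) → E) :
    extDeriv (fun z => wedge (a z) (b z)) y v =
      wedge (extDeriv a y) (b y) (v ∘ Fin.cast (Nat.add_right_comm p 1 q)) +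
        (-1) ^ p * wedge (a y) (extDeriv b y) v := by
  have h : HasFDerivAt (fun z => wedge (a z) (b z)) _ y :=
    (wedgeL E p q).hasFDerivAt_of_bilinear ha.hasFDerivAt hb.hasFDerivAt
  rw [extDeriv, h.fderiv, ContinuousAlternatingMap.alternatizeUncurryFin_add,
    ContinuousAlternatingMap.add_apply, add_comm, alternatizeUncurryFin_wedge_left,
    alternatizeUncurryFin_wedge_right]
  rfl

theorem map_vecCons_fderiv_of_mem_radical {k : ℕ} {X : E → E} {σ : E → E [⋀^Fin (k + 1)]→L[ℝ] ℝ}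
    {y : E} (hX : DifferentiableAt ℝ X y) (hσ : DifferentiableAt ℝ σ y)
    (h : ∀ᶠ z in nhds y, X z ∈ radical (σ z)) (u : E) (v : Fin k → E) :
    fderiv ℝ σ y u (Matrix.vecCons (X y) v) = -σ y (Matrix.vecCons (fderiv ℝ X y u) v) := by
  have hzero : HasFDerivAt (fun z => σ z (Matrix.vecCons (X z) v)) (0 : E →L[ℝ] ℝ) y := by
    refine (hasFDerivAt_const (0 : ℝ) y).congr_of_eventuallyEq ?_
    filter_upwards [h] with z hz
    exact map_eq_zero_of_mem_radical (i := 0) hz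
  have hderiv := hσ.hasFDerivAt.continuousAlternatingMap_apply
    (g := fun j z => Matrix.vecCons (X z) v j)
    (g' := Matrix.vecCons (fderiv ℝ X y) fun _ => 0) fun j => by
      induction j using Fin.cases with
      | zero => exact hX.hasFDerivAt
      | succ j => exact hasFDerivAt_const _ _
  have hupdate (x : E) : Function.update (Matrix.vecCons (X y) v) 0 x = Matrix.vecCons x v :=
    Fin.update_cons_zero _ _ _
  have happly := DFunLike.congr_fun (hderiv.unique hzero) u
  simp only [Fin.sum_univ_succ, Matrix.cons_val_zero, Matrix.cons_val_succ,
    ContinuousLinearMap.comp_zero, Finset.sum_const_zero, add_zero, add_apply,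
    ContinuousLinearMap.comp_apply, ContinuousAlternatingMap.apply_apply,
    ContinuousAlternatingMap.toContinuousLinearMap_apply, hupdate, zero_apply] at happly
  linarith

theorem lieDerivE_eq_extDeriv_of_mem_radical {k : ℕ} {X : E → E} {σ : E → E [⋀^Fin k]→L[ℝ] ℝ}
    {y : E} (hX : DifferentiableAt ℝ X y) (hσ : DifferentiableAt ℝ σ y)
    (h : ∀ᶠ z in nhds y, X z ∈ radical (σ z)) (v : Fin k → E) :
    lieDerivE X σ y v = extDeriv σ y (Matrix.vecCons (X y) v) := by
  rw [lieDerivE, extDeriv, ContinuousAlternatingMap.alternatizeUncurryFin_apply,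
    Fin.sum_univ_succ]
  congr 1
  · simp
  cases k with
  | zero => rfl
  | succ k =>
    refine Finset.sum_congr rfl fun i _ => ?_
    have hremove : i.succ.removeNth (Matrix.vecCons (X y) v) =
        Matrix.vecCons (X y) (i.removeNth v) := by
      funext j
      refine Fin.cases ?_ (fun j => ?_) j <;> simp [Fin.removeNth]
    have hupdate : Function.update v i (fderiv ℝ X y (v i)) =
        i.insertNth (fderiv ℝ X y (v i)) (i.removeNth v) := by
      rw [Fin.insertNth_removeNth]
    rw [hremove, hupdate, ContinuousAlternatingMap.map_insertNth, Matrix.cons_val_succ,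
      map_vecCons_fderiv_of_mem_radical hX hσ h, Fin.val_succ, pow_succ, mul_neg_one, neg_smul,
      smul_neg, neg_neg]

end Leibniz

/-! ### Forms in charts -/

section Charts

variable {E : Type*} [NormedAddCommGroup E] [NormedSpace ℝ E]
  {M : Type*} [TopologicalSpace M] [ChartedSpace E M] {k p q : ℕ}

/-- The pointwise wedge product of differential forms. -/
def FormField.wedge (a : FormField E M p) (b : FormField E M q) : FormField E M (p + q) :=
  fun x => FKContact.wedge (a x) (b x)

theorem FormField.apply_congr (σ : FormField E M k) {x x' : M} (h : x = x') :
    (σ x : E [⋀^Fin k]→L[ℝ] ℝ) = (σ x' : E [⋀^Fin k]→L[ℝ] ℝ) := by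
  subst h
  rfl

theorem chartForm_wedge (a : FormField E M p) (b : FormField E M q) (x₀ : M) :
    chartForm (a.wedge b) x₀ = fun y => wedge (chartForm a x₀ y) (chartForm b x₀ y) :=
  funext fun _ => wedge_compContinuousLinearMap _ _ _

theorem IsSmoothForm.wedge {a : FormField E M p} {b : FormField E M q} (ha : IsSmoothForm a)
    (hb : IsSmoothForm b) : IsSmoothForm (a.wedge b) := by
  intro x₀
  rw [chartForm_wedge]
  exact ((wedgeL E p q).isBoundedBilinearMap.contDiff.comp_contDiffOn
    ((ha x₀).prodMk (hb x₀)) :)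

theorem IsSmoothForm.contDiffAt {σ : FormField E M k} (h : IsSmoothForm σ) (x₀ : M)
    {y : E} (hy : y ∈ (extChartAt 𝓘(ℝ, E) x₀).target) : ContDiffAt ℝ ∞ (chartForm σ x₀) y :=
  (h x₀).contDiffAt ((isOpen_extChartAt_target x₀).mem_nhds hy)

variable (E) in
/-- The transition map from the chart at `x₀` to the chart at `x₁`. -/
def chartTrans (x₀ x₁ : M) : PartialEquiv E E :=
  (extChartAt 𝓘(ℝ, E) x₀).symm.trans (extChartAt 𝓘(ℝ, E) x₁)

theorem isOpen_chartTrans_source (x₀ x₁ : M) : IsOpen ((chartTrans E x₀ x₁).source) :=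
  (continuousOn_extChartAt_symm x₀).isOpen_inter_preimage (isOpen_extChartAt_target x₀)
    (isOpen_extChartAt_source x₁)

theorem chartTrans_mem_target {x₀ x₁ : M} {y : E} (hy : y ∈ (chartTrans E x₀ x₁).source) :
    chartTrans E x₀ x₁ y ∈ (extChartAt 𝓘(ℝ, E) x₁).target :=
  (extChartAt 𝓘(ℝ, E) x₁).map_source hy.2

theorem extChartAt_symm_chartTrans {x₀ x₁ : M} {y : E} (hy : y ∈ (chartTrans E x₀ x₁).source) :
    (extChartAt 𝓘(ℝ, E) x₁).symm (chartTrans E x₀ x₁ y) = (extChartAt 𝓘(ℝ, E) x₀).symm y :=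
  (extChartAt 𝓘(ℝ, E) x₁).left_inv hy.2

theorem mem_chartTrans_source_self (x₀ : M) {y : E} (hy : y ∈ (extChartAt 𝓘(ℝ, E) x₀).target) :
    y ∈ (chartTrans E x₀ ((extChartAt 𝓘(ℝ, E) x₀).symm y)).source :=
  ⟨hy, mem_extChartAt_source _⟩

variable [IsManifold 𝓘(ℝ, E) ∞ M]

theorem mdifferentiableAt_extChartAt_symm {x₀ : M} {y : E}
    (hy : y ∈ (extChartAt 𝓘(ℝ, E) x₀).target) :
    MDifferentiableAt 𝓘(ℝ, E) 𝓘(ℝ, E) (extChartAt 𝓘(ℝ, E) x₀).symm y := by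
  have h := mdifferentiableWithinAt_extChartAt_symm hy
  rwa [ModelWithCorners.range_eq_univ, mdifferentiableWithinAt_univ] at h

theorem isInvertible_mfderiv_extChartAt_symm {x₀ : M} {y : E}
    (hy : y ∈ (extChartAt 𝓘(ℝ, E) x₀).target) :
    (mfderiv 𝓘(ℝ, E) 𝓘(ℝ, E) (extChartAt 𝓘(ℝ, E) x₀).symm y).IsInvertible := by
  have h := isInvertible_mfderivWithin_extChartAt_symm (I := 𝓘(ℝ, E)) hy
  rwa [ModelWithCorners.range_eq_univ, mfderivWithin_univ] at h

theorem mfderiv_extChartAt_symm_self (x : M) :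
    (mfderiv 𝓘(ℝ, E) 𝓘(ℝ, E) (extChartAt 𝓘(ℝ, E) x).symm (extChartAt 𝓘(ℝ, E) x x) : E →L[ℝ] E) =
      ContinuousLinearMap.id ℝ E := by
  have h := mfderivWithin_range_extChartAt_symm (I := 𝓘(ℝ, E)) (x := x)
  rwa [ModelWithCorners.range_eq_univ, mfderivWithin_univ] at h

theorem contDiffAt_chartTrans {x₀ x₁ : M} {y : E} (hy : y ∈ (chartTrans E x₀ x₁).source) :
    ContDiffAt ℝ ∞ (chartTrans E x₀ x₁) y := by
  have h := contDiffWithinAt_ext_coord_change (I := 𝓘(ℝ, E)) (n := ∞) x₁ x₀ (y := y) (by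
    rwa [PartialEquiv.trans_source])
  rwa [ModelWithCorners.range_eq_univ, contDiffWithinAt_univ] at h

theorem mfderiv_extChartAt_symm_eq_comp {x₀ x₁ : M} {y : E} (hy : y ∈ (chartTrans E x₀ x₁).source) :
    (mfderiv 𝓘(ℝ, E) 𝓘(ℝ, E) (extChartAt 𝓘(ℝ, E) x₀).symm y : E →L[ℝ] E) =
      (mfderiv 𝓘(ℝ, E) 𝓘(ℝ, E) (extChartAt 𝓘(ℝ, E) x₁).symm (chartTrans E x₀ x₁ y) :
        E →L[ℝ] E).comp (fderiv ℝ (chartTrans E x₀ x₁) y) := by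
  have hsymm : (extChartAt 𝓘(ℝ, E) x₀).symm =ᶠ[nhds y]
      (extChartAt 𝓘(ℝ, E) x₁).symm ∘ chartTrans E x₀ x₁ := by
    filter_upwards [(isOpen_chartTrans_source x₀ x₁).mem_nhds hy] with z hz
    exact (extChartAt_symm_chartTrans hz).symm
  have hchain := mfderiv_comp (I := 𝓘(ℝ, E)) (I' := 𝓘(ℝ, E)) (I'' := 𝓘(ℝ, E)) y
    (mdifferentiableAt_extChartAt_symm (chartTrans_mem_target hy))
    ((contDiffAt_chartTrans hy).differentiableAt (by simp)).mdifferentiableAt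
  rw [mfderiv_eq_fderiv] at hchain
  exact (hsymm.mfderiv_eq (I := 𝓘(ℝ, E)) (I' := 𝓘(ℝ, E))).trans hchain

theorem fderiv_chartTrans_self {x₀ : M} {y : E} (hy : y ∈ (extChartAt 𝓘(ℝ, E) x₀).target) :
    fderiv ℝ (chartTrans E x₀ ((extChartAt 𝓘(ℝ, E) x₀).symm y)) y =
      (mfderiv 𝓘(ℝ, E) 𝓘(ℝ, E) (extChartAt 𝓘(ℝ, E) ((extChartAt 𝓘(ℝ, E) x₀).symm y))
        ((extChartAt 𝓘(ℝ, E) x₀).symm y) : E →L[ℝ] E).comp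
        (mfderiv 𝓘(ℝ, E) 𝓘(ℝ, E) (extChartAt 𝓘(ℝ, E) x₀).symm y : E →L[ℝ] E) := by
  rw [← mfderiv_eq_fderiv]
  exact mfderiv_comp (I := 𝓘(ℝ, E)) (I' := 𝓘(ℝ, E)) (I'' := 𝓘(ℝ, E)) y
    (mdifferentiableAt_extChartAt (I := 𝓘(ℝ, E)) (mem_chart_source E _))
    (mdifferentiableAt_extChartAt_symm hy)

theorem chartForm_eq_chartTrans_pullback (σ : FormField E M k) {x₀ x₁ : M} {y : E}
    (hy : y ∈ (chartTrans E x₀ x₁).source) :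
    chartForm σ x₀ y = (chartForm σ x₁ (chartTrans E x₀ x₁ y)).compContinuousLinearMap
      (fderiv ℝ (chartTrans E x₀ x₁) y) := by
  refine (congrArg (fun a : E [⋀^Fin k]→L[ℝ] ℝ => a.compContinuousLinearMap
    (mfderiv 𝓘(ℝ, E) 𝓘(ℝ, E) (extChartAt 𝓘(ℝ, E) x₀).symm y : E →L[ℝ] E))
    (σ.apply_congr (extChartAt_symm_chartTrans hy).symm)).trans ?_
  erw [mfderiv_extChartAt_symm_eq_comp hy]
  rfl

theorem chartForm_self (σ : FormField E M k) (x : M) :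
    chartForm σ x (extChartAt 𝓘(ℝ, E) x x) = (σ x : E [⋀^Fin k]→L[ℝ] ℝ) := by
  rw [← σ.apply_congr (extChartAt_to_inv (I := 𝓘(ℝ, E)) x)]
  unfold chartForm
  erw [mfderiv_extChartAt_symm_self]
  rfl

theorem minSmoothness_two_le_infty : minSmoothness ℝ 2 ≤ (∞ : WithTop ℕ∞) := by
  rw [minSmoothness_of_isRCLikeNormedField]
  exact WithTop.coe_le_coe.2 le_top

theorem chartForm_extDer {σ : FormField E M k} (hσ : IsSmoothForm σ) (x₀ : M) {y : E}
    (hy : y ∈ (extChartAt 𝓘(ℝ, E) x₀).target) :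
    chartForm (extDer σ) x₀ y = extDeriv (chartForm σ x₀) y := by
  obtain ⟨x₁, hx₁⟩ : ∃ x₁, (extChartAt 𝓘(ℝ, E) x₀).symm y = x₁ := ⟨_, rfl⟩
  have hy' : y ∈ (chartTrans E x₀ x₁).source := hx₁ ▸ mem_chartTrans_source_self x₀ hy
  have hpull : chartForm σ x₀ =ᶠ[nhds y] fun z =>
      (chartForm σ x₁ (chartTrans E x₀ x₁ z)).compContinuousLinearMap
        (fderiv ℝ (chartTrans E x₀ x₁) z) := by
    filter_upwards [(isOpen_chartTrans_source x₀ x₁).mem_nhds hy'] with z hz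
    exact chartForm_eq_chartTrans_pullback σ hz
  rw [hpull.extDeriv_eq, extDeriv_pullback
    ((hσ.contDiffAt _ (chartTrans_mem_target hy')).differentiableAt (by simp))
    (contDiffAt_chartTrans hy') minSmoothness_two_le_infty]
  subst hx₁
  rw [fderiv_chartTrans_self hy]
  rfl

theorem extDer_eq_extDeriv (σ : FormField E M k) (x : M) :
    (extDer σ x : E [⋀^Fin (k + 1)]→L[ℝ] ℝ) =
      extDeriv (chartForm σ x) (extChartAt 𝓘(ℝ, E) x x) := by
  have h : (mfderiv 𝓘(ℝ, E) 𝓘(ℝ, E) (extChartAt 𝓘(ℝ, E) x) x : E →L[ℝ] E) =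
    ContinuousLinearMap.id ℝ E := mfderiv_extChartAt_self
  unfold extDer
  erw [h]
  rfl

theorem IsSmoothForm.extDer {σ : FormField E M k} (hσ : IsSmoothForm σ) :
    IsSmoothForm (extDer σ) := by
  intro x₀
  have h : ContDiffOn ℝ ∞ (fun y => extDeriv (chartForm σ x₀) y)
      (extChartAt 𝓘(ℝ, E) x₀).target := by
    refine ContDiff.comp_contDiffOn
      (g := ContinuousAlternatingMap.alternatizeUncurryFinCLM ℝ E ℝ (n := k))
      (ContinuousLinearMap.contDiff _) ?_
    exact (hσ x₀).fderiv_of_isOpen (isOpen_extChartAt_target x₀) (by simp)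
  exact h.congr fun y hy => chartForm_extDer hσ x₀ hy

theorem extDer_extDer {σ : FormField E M k} (hσ : IsSmoothForm σ) : extDer (extDer σ) = 0 := by
  funext x
  have hchart : chartForm (extDer σ) x =ᶠ[nhds (extChartAt 𝓘(ℝ, E) x x)]
      extDeriv (chartForm σ x) := by
    filter_upwards [extChartAt_target_mem_nhds x] with y hy
    exact chartForm_extDer hσ x hy
  refine (extDer_eq_extDeriv _ x).trans (hchart.extDeriv_eq.trans ?_)
  exact extDeriv_extDeriv_apply (hσ.contDiffAt x (mem_extChartAt_target x))
    minSmoothness_two_le_infty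

theorem extDer_wedge_apply {a : FormField E M p} {b : FormField E M q} (ha : IsSmoothForm a)
    (hb : IsSmoothForm b) (x : M) (v : Fin (p + q + 1) → TangentSpace 𝓘(ℝ, E) x) :
    extDer (a.wedge b) x v =
      wedge (extDer a x) (b x) (v ∘ Fin.cast (Nat.add_right_comm p 1 q)) +
        (-1) ^ p * wedge (a x) (extDer b x) v := by
  have h := extDeriv_wedge_apply (ha.differentiableAt x) (hb.differentiableAt x) v
  rw [chartForm_self, chartForm_self, ← extDer_eq_extDeriv, ← extDer_eq_extDeriv,
    ← chartForm_wedge a b] at h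
  exact (DFunLike.congr_fun (extDer_eq_extDeriv _ x) v).trans h

theorem extDer_wedge_one {a : FormField E M p} {b : FormField E M 1} (ha : IsSmoothForm a)
    (hb : IsSmoothForm b) :
    extDer (a.wedge b) = (extDer a).wedge b + (-1 : ℝ) ^ p • a.wedge (extDer b) :=
  funext fun x => ContinuousAlternatingMap.ext fun v => extDer_wedge_apply ha hb x v

theorem extDer_wedge_two_of_closed {a : FormField E M p} {b : FormField E M 2}
    (ha : IsSmoothForm a) (hb : IsSmoothForm b) (hdb : extDer b = 0) :
    extDer (a.wedge b) = (extDer a).wedge b := by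
  funext x
  refine ContinuousAlternatingMap.ext fun v => (extDer_wedge_apply ha hb x v).trans ?_
  rw [hdb, FormField.zero_apply, wedge_zero_right]
  exact add_eq_left.2 (mul_zero _)

theorem chartVField_differentiableAt [CompleteSpace E] {X : VField E M} (hX : IsSmoothVField X)
    (x : M) : DifferentiableAt ℝ (chartVField X x) (extChartAt 𝓘(ℝ, E) x x) := by
  have hsection : ContMDiffAt 𝓘(ℝ, E) (𝓘(ℝ, E).prod 𝓘(ℝ, E)) 1
      (fun x => Bundle.TotalSpace.mk' E x (X x))
      ((extChartAt 𝓘(ℝ, E) x).symm (extChartAt 𝓘(ℝ, E) x x)) :=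
    (hX _).of_le (by simp)
  have hsymm : ContMDiffAt 𝓘(ℝ, E) 𝓘(ℝ, E) ∞ (extChartAt 𝓘(ℝ, E) x).symm
      (extChartAt 𝓘(ℝ, E) x x) :=
    (contMDiffOn_extChartAt_symm x).contMDiffAt (extChartAt_target_mem_nhds x)
  have hpull := ContMDiffAt.mpullback_vectorField_preimage hsection hsymm
    (isInvertible_mfderiv_extChartAt_symm (mem_extChartAt_target x)) (WithTop.coe_le_coe.2 le_top)
  exact (contMDiffAt_vectorSpace_iff_contDiffAt.1 hpull).differentiableAt one_ne_zero

theorem chartVField_mem_radical_chartForm {σ : FormField E M k} {X : VField E M}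
    (h : ∀ x, X x ∈ radical (σ x)) (x₀ : M) {y : E}
    (hy : y ∈ (extChartAt 𝓘(ℝ, E) x₀).target) :
    chartVField X x₀ y ∈ radical (chartForm σ x₀ y) := by
  intro v i
  have hinv := isInvertible_mfderiv_extChartAt_symm hy
  have hpush : mfderiv 𝓘(ℝ, E) 𝓘(ℝ, E) (extChartAt 𝓘(ℝ, E) x₀).symm y
      (chartVField X x₀ y : E) = X ((extChartAt 𝓘(ℝ, E) x₀).symm y) :=
    hinv.self_apply_inverse _
  refine map_eq_zero_of_mem_radical (a := σ ((extChartAt 𝓘(ℝ, E) x₀).symm y)) (i := i) ?_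
  simp only [Function.update_self]
  exact hpush ▸ h _

theorem lieDer_eq_zero_of_closed [CompleteSpace E] {σ : FormField E M k} (hσ : IsSmoothForm σ)
    (hd : extDer σ = 0) {X : VField E M} (hX : IsSmoothVField X)
    (h : ∀ x, X x ∈ radical (σ x)) (x : M) (v : Fin k → TangentSpace 𝓘(ℝ, E) x) :
    lieDer X σ x v = 0 := by
  refine (lieDerivE_eq_extDeriv_of_mem_radical (chartVField_differentiableAt hX x)
    (hσ.differentiableAt x) ?_ _).trans ?_
  · filter_upwards [extChartAt_target_mem_nhds x] with y hy
    exact chartVField_mem_radical_chartForm h x hy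
  · rw [← extDer_eq_extDeriv, hd]
    rfl

end Charts

/-! ### Stokes' theorem -/

open MeasureTheory Topology

section VectorSpace

variable {E : Type*} [NormedAddCommGroup E] [NormedSpace ℝ E] {N d : ℕ}

theorem compContinuousLinearMap_apply_basis (e : Module.Basis (Fin N) ℝ E)
    (a : E [⋀^Fin N]→L[ℝ] ℝ) (L : E →L[ℝ] E) :
    a.compContinuousLinearMap L e = L.det * a e := by
  have hdet : e.det (L ∘ e) = L.det :=
    (e.det_comp L.toLinearMap e).trans (by rw [e.det_self, mul_one])
  rw [← hdet, mul_comm]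
  exact DFunLike.congr_fun (a.toAlternatingMap.eq_smul_basis_det e) (L ∘ e)

theorem extDeriv_eq_zero_of_eventuallyEq_zero {G : E → E [⋀^Fin d]→L[ℝ] ℝ} {y : E}
    (h : G =ᶠ[𝓝 y] 0) : extDeriv G y = 0 := by
  rw [h.extDeriv_eq]
  simpa using extDeriv_smul (x := y) (0 : ℝ) (0 : E → E [⋀^Fin d]→L[ℝ] ℝ)

variable [MeasurableSpace E] [BorelSpace E] (μ : Measure E)

theorem integrable_fderiv_apply [IsFiniteMeasureOnCompacts μ] {g : E → ℝ} (hg : ContDiff ℝ 1 g)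
    (hc : HasCompactSupport g) (v : E) : Integrable (fun y => fderiv ℝ g y v) μ :=
  ((hg.continuous_fderiv one_ne_zero).clm_apply continuous_const).integrable_of_hasCompactSupport
    (hc.fderiv_apply ℝ v)

variable [FiniteDimensional ℝ E] [μ.IsAddHaarMeasure]

theorem integral_fderiv_apply_eq_zero {g : E → ℝ} (hg : ContDiff ℝ 1 g) (hc : HasCompactSupport g)
    (v : E) : ∫ y, fderiv ℝ g y v ∂μ = 0 := by
  simpa using integral_mul_fderiv_eq_neg_fderiv_mul_of_integrable (μ := μ) (𝕜 := ℝ)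
    (f := fun _ : E => (1 : ℝ)) (g := g) (v := v) (by simp)
    (by simpa using integrable_fderiv_apply μ hg hc v)
    (by simpa using hg.continuous.integrable_of_hasCompactSupport hc)
    (fun x _ => differentiableAt_const _) (fun x _ => hg.differentiable one_ne_zero x)

theorem integral_extDeriv_eq_zero {G : E → E [⋀^Fin d]→L[ℝ] ℝ} (hG : ContDiff ℝ 1 G)
    (hc : HasCompactSupport G) (v : Fin (d + 1) → E) : ∫ y, extDeriv G y v ∂μ = 0 := by
  have hGw (w : Fin d → E) : ContDiff ℝ 1 fun y => G y w :=
    (ContinuousAlternatingMap.apply ℝ E ℝ w).contDiff.comp hG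
  have hcw (w : Fin d → E) : HasCompactSupport fun y => G y w :=
    hc.comp_left (g := fun a : E [⋀^Fin d]→L[ℝ] ℝ => a w) rfl
  simp_rw [extDeriv_apply (hG.differentiable one_ne_zero _) v, zsmul_eq_mul]
  rw [integral_finsetSum _ fun i _ => (integrable_fderiv_apply μ (hGw _) (hcw _) _).const_mul _]
  refine Finset.sum_eq_zero fun i _ => ?_
  rw [integral_const_mul, integral_fderiv_apply_eq_zero μ (hGw _) (hcw _), mul_zero]

theorem setIntegral_mul_extDeriv_eq_zero {G : E → E [⋀^Fin d]→L[ℝ] ℝ} {U K : Set E}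
    (hU : IsOpen U) (hK : IsCompact K) (hKU : K ⊆ U) (hG : ContDiffOn ℝ 1 G U)
    (hGK : ∀ y ∈ U \ K, G y = 0) {o : E → SignType} (ho : ContinuousOn o U)
    (v : Fin (d + 1) → E) : ∫ y in U, (o y : ℝ) * extDeriv G y v ∂μ = 0 := by
  classical
  set H : E → E [⋀^Fin d]→L[ℝ] ℝ := U.indicator fun y => (o y : ℝ) • G y
  have hHK (y : E) (hy : y ∉ K) : H y = 0 := by
    by_cases hyU : y ∈ U
    · simp only [H, Set.indicator_of_mem hyU, hGK y ⟨hyU, hy⟩, smul_zero]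
    · exact Set.indicator_of_notMem hyU _
  have hH_near {y : E} (hy : y ∈ U) : H =ᶠ[𝓝 y] (o y : ℝ) • G := by
    have hconst : ∀ᶠ z in 𝓝 y, o z = o y :=
      (ho.continuousAt (hU.mem_nhds hy)).eventually ((isOpen_discrete {o y}).mem_nhds rfl)
    filter_upwards [hconst, hU.mem_nhds hy] with z hz hzU
    simp only [H, Set.indicator_of_mem hzU, hz, Pi.smul_apply]
  have hH_far {y : E} (hy : y ∉ U) : H =ᶠ[𝓝 y] 0 := by
    filter_upwards [hK.isClosed.isOpen_compl.mem_nhds fun h => hy (hKU h)] with z hz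
    exact hHK z hz
  have hH : ContDiff ℝ 1 H := contDiff_iff_contDiffAt.2 fun y => by
    by_cases hy : y ∈ U
    · exact ((hG.contDiffAt (hU.mem_nhds hy)).const_smul (o y : ℝ)).congr_of_eventuallyEq
        (hH_near hy)
    · exact contDiffAt_const.congr_of_eventuallyEq (hH_far hy)
  rw [← integral_extDeriv_eq_zero μ hH (HasCompactSupport.intro hK hHK) v,
    ← integral_indicator hU.measurableSet]
  congr 1 with y
  by_cases hy : y ∈ U
  · rw [Set.indicator_of_mem hy, (hH_near hy).extDeriv_eq, extDeriv_smul]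
    rfl
  · rw [Set.indicator_of_notMem hy, extDeriv_eq_zero_of_eventuallyEq_zero (hH_far hy)]
    rfl

end VectorSpace

section ChartIntegral

variable {E : Type*} [NormedAddCommGroup E] [NormedSpace ℝ E]
  {M : Type*} [TopologicalSpace M] [ChartedSpace E M] {k N d : ℕ}

/-- The product of a function and a differential form. -/
def FormField.funSMul (r : M → ℝ) (σ : FormField E M k) : FormField E M k := fun x => r x • σ x

/-- A volume form: a smooth form without zeros, to be used in the top degree. -/
structure IsVolumeForm (σ : FormField E M k) : Prop where
  smooth : IsSmoothForm σ
  ne_zero : ∀ x, σ x ≠ 0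

/-- The form vanishes outside a closed set contained in the domain of the chart at `x₀`. -/
def FormField.SupportedInChart (σ : FormField E M k) (x₀ : M) : Prop :=
  ∃ K : Set M, IsClosed K ∧ K ⊆ (extChartAt 𝓘(ℝ, E) x₀).source ∧ ∀ x ∉ K, σ x = 0

/-- The coefficient of a top form in the chart at `x₀`, relative to the basis `e` of `E`. -/
def chartDensity (e : Module.Basis (Fin N) ℝ E) (σ : FormField E M N) (x₀ : M) (y : E) : ℝ :=
  chartForm σ x₀ y e

/-- The integral of the top form `α` over the chart at `x₀`, for the orientation in which the
volume form `σ` is positive. -/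
def chartIntegral [MeasurableSpace E] (μ : Measure E) (e : Module.Basis (Fin N) ℝ E)
    (σ : FormField E M N) (x₀ : M) (α : FormField E M N) : ℝ :=
  ∫ y in (extChartAt 𝓘(ℝ, E) x₀).target,
    (SignType.sign (chartDensity e σ x₀ y) : ℝ) * chartDensity e α x₀ y ∂μ

theorem chartForm_eq_zero_of_apply_eq_zero {σ : FormField E M k} {x₀ : M} {y : E}
    (h : σ ((extChartAt 𝓘(ℝ, E) x₀).symm y) = 0) : chartForm σ x₀ y = 0 := by
  rw [chartForm, h]
  rfl

theorem chartDensity_eq_zero_of_apply_eq_zero (e : Module.Basis (Fin N) ℝ E) {σ : FormField E M N}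
    {x₀ : M} {y : E} (h : σ ((extChartAt 𝓘(ℝ, E) x₀).symm y) = 0) : chartDensity e σ x₀ y = 0 := by
  rw [chartDensity, chartForm_eq_zero_of_apply_eq_zero h]
  rfl

theorem chartDensity_sum (e : Module.Basis (Fin N) ℝ E) {ι : Type*} (s : Finset ι)
    (α : ι → FormField E M N) (x₀ : M) (y : E) :
    chartDensity e (∑ i ∈ s, α i) x₀ y = ∑ i ∈ s, chartDensity e (α i) x₀ y := by
  let density : FormField E M N →+ ℝ :=
    ⟨⟨fun α => chartDensity e α x₀ y, rfl⟩, fun _ _ => rfl⟩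
  exact map_sum density α s

theorem chartDensity_funSMul (e : Module.Basis (Fin N) ℝ E) (r : M → ℝ) (α : FormField E M N)
    (x₀ : M) (y : E) : chartDensity e (α.funSMul r) x₀ y =
      r ((extChartAt 𝓘(ℝ, E) x₀).symm y) * chartDensity e α x₀ y :=
  rfl

theorem IsSmoothForm.continuousOn_chartDensity {σ : FormField E M N} (hσ : IsSmoothForm σ)
    (e : Module.Basis (Fin N) ℝ E) (x₀ : M) :
    ContinuousOn (chartDensity e σ x₀) (extChartAt 𝓘(ℝ, E) x₀).target :=
  (ContinuousAlternatingMap.apply ℝ E ℝ e).continuous.comp_continuousOn (hσ x₀).continuousOn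

namespace FormField.SupportedInChart

variable {σ : FormField E M k} {x₀ : M}

theorem apply_eq_zero (h : σ.SupportedInChart x₀) {x : M}
    (hx : x ∉ (extChartAt 𝓘(ℝ, E) x₀).source) : σ x = 0 :=
  let ⟨_, _, hK, hσ⟩ := h
  hσ x fun hxK => hx (hK hxK)

theorem funSMul (h : σ.SupportedInChart x₀) (r : M → ℝ) : (σ.funSMul r).SupportedInChart x₀ := by
  obtain ⟨K, hKc, hK, hσ⟩ := h
  exact ⟨K, hKc, hK, fun x hx => by rw [FormField.funSMul, hσ x hx, smul_zero]⟩

theorem exists_isCompact [CompactSpace M] (h : σ.SupportedInChart x₀) :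
    ∃ K ⊆ (extChartAt 𝓘(ℝ, E) x₀).target, IsCompact K ∧
      ∀ y ∈ (extChartAt 𝓘(ℝ, E) x₀).target \ K, chartForm σ x₀ y = 0 := by
  obtain ⟨K, hKc, hK, hσ⟩ := h
  refine ⟨extChartAt 𝓘(ℝ, E) x₀ '' K, ?_, ?_, ?_⟩
  · exact Set.image_subset_iff.2 fun x hx => (extChartAt 𝓘(ℝ, E) x₀).map_source (hK hx)
  · exact hKc.isCompact.image_of_continuousOn ((continuousOn_extChartAt x₀).mono hK)
  · rintro y ⟨hy, hyK⟩
    exact chartForm_eq_zero_of_apply_eq_zero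
      (hσ _ fun h => hyK ⟨_, h, (extChartAt 𝓘(ℝ, E) x₀).right_inv hy⟩)

end FormField.SupportedInChart

theorem FormField.supportedInChart_funSMul {r : M → ℝ} {x₀ : M}
    (hr : tsupport r ⊆ (extChartAt 𝓘(ℝ, E) x₀).source) (σ : FormField E M k) :
    (σ.funSMul r).SupportedInChart x₀ :=
  ⟨tsupport r, isClosed_tsupport r, hr, fun x hx => by
    rw [FormField.funSMul, image_eq_zero_of_notMem_tsupport hx, zero_smul]⟩

theorem chartIntegral_eq_integral_chartTrans_source [MeasurableSpace E] [BorelSpace E]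
    (μ : Measure E) (e : Module.Basis (Fin N) ℝ E) (σ : FormField E M N) {α : FormField E M N}
    (x₀ : M) {x₁ : M} (hα : α.SupportedInChart x₁) :
    chartIntegral μ e σ x₀ α = ∫ y in (chartTrans E x₀ x₁).source,
      (SignType.sign (chartDensity e σ x₀ y) : ℝ) * chartDensity e α x₀ y ∂μ := by
  refine setIntegral_eq_of_subset_of_forall_sdiff_eq_zero
    (isOpen_extChartAt_target x₀).measurableSet Set.inter_subset_left fun y hy => ?_
  simp only [chartDensity_eq_zero_of_apply_eq_zero e
    (hα.apply_eq_zero fun h => hy.2 ⟨hy.1, h⟩), mul_zero]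

theorem chartIntegral_funSMul_self [MeasurableSpace E] (μ : Measure E)
    (e : Module.Basis (Fin N) ℝ E) (σ : FormField E M N) (x₀ : M) (r : M → ℝ) :
    chartIntegral μ e σ x₀ (σ.funSMul r) = ∫ y in (extChartAt 𝓘(ℝ, E) x₀).target,
      r ((extChartAt 𝓘(ℝ, E) x₀).symm y) * |chartDensity e σ x₀ y| ∂μ := by
  simp_rw [chartIntegral, chartDensity_funSMul, mul_left_comm, sign_mul_self]

theorem chartIntegral_funSMul_self_nonneg [MeasurableSpace E] (μ : Measure E)
    (e : Module.Basis (Fin N) ℝ E) (σ : FormField E M N) (x₀ : M) {r : M → ℝ} (hr₀ : ∀ x, 0 ≤ r x) :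
    0 ≤ chartIntegral μ e σ x₀ (σ.funSMul r) := by
  rw [chartIntegral_funSMul_self]
  exact integral_nonneg fun _ => mul_nonneg (hr₀ _) (abs_nonneg _)

variable [IsManifold 𝓘(ℝ, E) ∞ M] {σ α : FormField E M N}

theorem IsSmoothForm.funSMul {σ : FormField E M k} (hσ : IsSmoothForm σ) {r : M → ℝ}
    (hr : ContMDiff 𝓘(ℝ, E) 𝓘(ℝ, ℝ) ∞ r) : IsSmoothForm (σ.funSMul r) := fun x₀ =>
  ContDiffOn.smul (hr.comp_contMDiffOn (contMDiffOn_extChartAt_symm x₀)).contDiffOn (hσ x₀)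

theorem chartForm_ne_zero {σ : FormField E M k} {x₀ : M} {y : E}
    (hσ : σ ((extChartAt 𝓘(ℝ, E) x₀).symm y) ≠ 0)
    (hy : y ∈ (extChartAt 𝓘(ℝ, E) x₀).target) : chartForm σ x₀ y ≠ 0 := by
  intro h
  have hinv := isInvertible_mfderiv_extChartAt_symm hy
  refine hσ (ContinuousAlternatingMap.ext fun v => ?_)
  have hv := DFunLike.congr_fun h fun i =>
    (mfderiv 𝓘(ℝ, E) 𝓘(ℝ, E) (extChartAt 𝓘(ℝ, E) x₀).symm y).inverse (v i)
  refine Eq.trans (congrArg _ (funext fun i => ?_)) hv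
  exact (hinv.self_apply_inverse _).symm

theorem chartDensity_ne_zero (e : Module.Basis (Fin N) ℝ E) (hσ : ∀ x, σ x ≠ 0) {x₀ : M} {y : E}
    (hy : y ∈ (extChartAt 𝓘(ℝ, E) x₀).target) : chartDensity e σ x₀ y ≠ 0 :=
  (AlternatingMap.map_basis_ne_zero_iff e (chartForm σ x₀ y).toAlternatingMap).2 fun h =>
    chartForm_ne_zero (hσ _) hy (ContinuousAlternatingMap.toAlternatingMap_injective h)

theorem IsVolumeForm.continuousOn_sign_chartDensity (hσ : IsVolumeForm σ)
    (e : Module.Basis (Fin N) ℝ E) (x₀ : M) :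
    ContinuousOn (fun y => SignType.sign (chartDensity e σ x₀ y))
      (extChartAt 𝓘(ℝ, E) x₀).target := fun y hy =>
  (continuousAt_sign_of_ne_zero (chartDensity_ne_zero e hσ.ne_zero hy)).comp_continuousWithinAt
    (hσ.smooth.continuousOn_chartDensity e x₀ y hy)

theorem chartDensity_chartTrans (e : Module.Basis (Fin N) ℝ E) (σ : FormField E M N) {x₀ x₁ : M}
    {y : E} (hy : y ∈ (chartTrans E x₀ x₁).source) :
    chartDensity e σ x₀ y =
      (fderiv ℝ (chartTrans E x₀ x₁) y).det * chartDensity e σ x₁ (chartTrans E x₀ x₁ y) := by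
  rw [chartDensity, chartForm_eq_chartTrans_pullback σ hy, compContinuousLinearMap_apply_basis]
  rfl

theorem FormField.SupportedInChart.extDer {γ : FormField E M k} {x₀ : M}
    (h : γ.SupportedInChart x₀) : (extDer γ).SupportedInChart x₀ := by
  obtain ⟨K, hKc, hK, hγ⟩ := h
  refine ⟨K, hKc, hK, fun x hx => (extDer_eq_extDeriv γ x).trans
    (extDeriv_eq_zero_of_eventuallyEq_zero ?_)⟩
  have hsymm := continuousAt_extChartAt_symm (I := 𝓘(ℝ, E)) x
  rw [ContinuousAt, extChartAt_to_inv] at hsymm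
  filter_upwards [hsymm.eventually (hKc.isOpen_compl.mem_nhds hx)] with y hy
  exact chartForm_eq_zero_of_apply_eq_zero (hγ _ hy)

variable [MeasurableSpace E] [BorelSpace E] (μ : Measure E) (e : Module.Basis (Fin N) ℝ E)

theorem integrableOn_chart [IsFiniteMeasureOnCompacts μ] [CompactSpace M] (hσ : IsVolumeForm σ)
    (hα : IsSmoothForm α) {x₀ : M} (hα₀ : α.SupportedInChart x₀) :
    IntegrableOn (fun y => (SignType.sign (chartDensity e σ x₀ y) : ℝ) * chartDensity e α x₀ y)
      (extChartAt 𝓘(ℝ, E) x₀).target μ := by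
  obtain ⟨K, hK, hKc, hαK⟩ := hα₀.exists_isCompact
  have hcont := ((continuous_of_discreteTopology (f := ((↑) : SignType → ℝ))).comp_continuousOn
    (hσ.continuousOn_sign_chartDensity e x₀)).mul (hα.continuousOn_chartDensity e x₀)
  refine ((hcont.mono hK).integrableOn_compact hKc).of_forall_sdiff_eq_zero
    (isOpen_extChartAt_target x₀).measurableSet fun y hy => ?_
  have hzero : chartDensity e α x₀ y = 0 := by
    rw [chartDensity, hαK y hy]
    rfl
  exact mul_eq_zero_of_right _ hzero

theorem chartIntegral_sum [IsFiniteMeasureOnCompacts μ] [CompactSpace M] (hσ : IsVolumeForm σ)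
    {x₀ : M} {ι : Type*} (s : Finset ι) {α : ι → FormField E M N}
    (hα : ∀ i, IsSmoothForm (α i)) (hα₀ : ∀ i, (α i).SupportedInChart x₀) :
    chartIntegral μ e σ x₀ (∑ i ∈ s, α i) = ∑ i ∈ s, chartIntegral μ e σ x₀ (α i) := by
  simp_rw [chartIntegral, chartDensity_sum, Finset.mul_sum]
  exact integral_finsetSum _ fun i _ => integrableOn_chart μ e hσ (hα i) (hα₀ i)

theorem chartIntegral_funSMul_self_pos [IsFiniteMeasureOnCompacts μ] [μ.IsOpenPosMeasure]
    [CompactSpace M] (hσ : IsVolumeForm σ) {x₀ : M} {r : M → ℝ}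
    (hr : ContMDiff 𝓘(ℝ, E) 𝓘(ℝ, ℝ) ∞ r) (hr₀ : ∀ x, 0 ≤ r x)
    (hrs : tsupport r ⊆ (extChartAt 𝓘(ℝ, E) x₀).source) {x : M} (hx : 0 < r x) :
    0 < chartIntegral μ e σ x₀ (σ.funSMul r) := by
  have hintegrable := integrableOn_chart μ e hσ (hσ.smooth.funSMul hr)
    (σ.supportedInChart_funSMul hrs)
  simp_rw [chartDensity_funSMul, mul_left_comm, sign_mul_self] at hintegrable
  rw [chartIntegral_funSMul_self, setIntegral_pos_iff_support_of_nonneg_ae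
    (.of_forall fun y => mul_nonneg (hr₀ _) (abs_nonneg _)) hintegrable]
  set φ := extChartAt 𝓘(ℝ, E) x₀
  have hopen : IsOpen (φ.target ∩ φ.symm ⁻¹' {z | 0 < r z}) :=
    (continuousOn_extChartAt_symm x₀).isOpen_inter_preimage
      (isOpen_extChartAt_target x₀) (isOpen_lt continuous_const hr.continuous)
  have hxs : x ∈ φ.source := hrs (subset_tsupport r hx.ne')
  have hnonempty : (φ.target ∩ φ.symm ⁻¹' {z | 0 < r z}).Nonempty :=
    ⟨φ x, φ.map_source hxs, by rwa [Set.mem_preimage, φ.left_inv hxs]⟩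
  refine (hopen.measure_pos μ hnonempty).trans_le (measure_mono ?_)
  rintro y ⟨hy, hry⟩
  exact ⟨mul_ne_zero (ne_of_gt hry) (abs_ne_zero.2 (chartDensity_ne_zero e hσ.ne_zero hy)), hy⟩

variable [FiniteDimensional ℝ E] [μ.IsAddHaarMeasure]

theorem chartIntegral_congr_chart (σ : FormField E M N) {x₀ x₁ : M}
    (h₀ : α.SupportedInChart x₀) (h₁ : α.SupportedInChart x₁) :
    chartIntegral μ e σ x₀ α = chartIntegral μ e σ x₁ α := by
  have himage : chartTrans E x₀ x₁ '' (chartTrans E x₀ x₁).source = (chartTrans E x₁ x₀).source :=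
    (chartTrans E x₀ x₁).image_source_eq_target
  rw [chartIntegral_eq_integral_chartTrans_source μ e σ x₀ h₁,
    chartIntegral_eq_integral_chartTrans_source μ e σ x₁ h₀, ← himage,
    integral_image_eq_integral_abs_det_fderiv_smul μ
      (isOpen_chartTrans_source x₀ x₁).measurableSet
      (fun y hy => ((contDiffAt_chartTrans hy).differentiableAt
        (by simp)).hasFDerivAt.hasFDerivWithinAt) (chartTrans E x₀ x₁).injOn]
  refine setIntegral_congr_fun (isOpen_chartTrans_source x₀ x₁).measurableSet fun y hy => ?_
  simp only [smul_eq_mul]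
  rw [chartDensity_chartTrans e σ hy, chartDensity_chartTrans e α hy, sign_mul, SignType.coe_mul,
    ← sign_mul_self]
  ring

theorem chartIntegral_extDer_eq_zero [CompactSpace M] (e : Module.Basis (Fin (d + 1)) ℝ E)
    {σ : FormField E M (d + 1)} (hσ : IsVolumeForm σ) {γ : FormField E M d} (hγ : IsSmoothForm γ)
    {x₀ : M} (hγ₀ : γ.SupportedInChart x₀) : chartIntegral μ e σ x₀ (extDer γ) = 0 := by
  obtain ⟨K, hK, hKc, hγK⟩ := hγ₀.exists_isCompact
  have htarget : IsOpen (extChartAt 𝓘(ℝ, E) x₀).target := isOpen_extChartAt_target x₀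
  refine (setIntegral_congr_fun htarget.measurableSet fun y hy => ?_).trans
    (setIntegral_mul_extDeriv_eq_zero μ htarget hKc hK ((hγ x₀).of_le (by simp)) hγK
      (hσ.continuousOn_sign_chartDensity e x₀) e)
  simp only [chartDensity]
  rw [chartForm_extDer hγ x₀ hy]

end ChartIntegral

section ExactTopForms

variable {E : Type*} [NormedAddCommGroup E] [NormedSpace ℝ E]
  {M : Type*} [TopologicalSpace M] [ChartedSpace E M] {k N d : ℕ}

theorem isSmoothForm_sum {ι : Type*} (s : Finset ι) {σ : ι → FormField E M k}
    (hσ : ∀ i, IsSmoothForm (σ i)) : IsSmoothForm (∑ i ∈ s, σ i) :=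
  Finset.sum_induction _ _ (fun _ _ ha hb x₀ => (ha x₀).add (hb x₀)) isSmoothForm_zero
    fun i _ => hσ i

theorem extDer_sum {ι : Type*} (s : Finset ι) {σ : ι → FormField E M k}
    (hσ : ∀ i, IsSmoothForm (σ i)) : extDer (∑ i ∈ s, σ i) = ∑ i ∈ s, extDer (σ i) := by
  classical
  induction s using Finset.induction_on with
  | empty => exact extDer_zero
  | insert i s hi ih =>
    rw [Finset.sum_insert hi, Finset.sum_insert hi,
      extDer_add (hσ i) (isSmoothForm_sum s hσ), ih]

theorem FormField.funSMul_sum {ι : Type*} (s : Finset ι) (r : M → ℝ) (σ : ι → FormField E M k) :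
    FormField.funSMul r (∑ i ∈ s, σ i) = ∑ i ∈ s, (σ i).funSMul r :=
  map_sum (⟨⟨FormField.funSMul r, funext fun _ => smul_zero _⟩,
    fun _ _ => funext fun _ => smul_add ..⟩ : FormField E M k →+ FormField E M k) σ s

variable (E M) in
theorem exists_finite_subordinate_partition [FiniteDimensional ℝ E]
    [IsManifold 𝓘(ℝ, E) ∞ M] [T2Space M] [CompactSpace M] :
    ∃ (t : Finset M) (f : SmoothPartitionOfUnity t 𝓘(ℝ, E) M),
      f.IsSubordinate fun i => (extChartAt 𝓘(ℝ, E) (i : M)).source := by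
  obtain ⟨t, ht⟩ := isCompact_univ.elim_finite_subcover
    (fun x : M => (extChartAt 𝓘(ℝ, E) x).source) isOpen_extChartAt_source
    fun x _ => Set.mem_iUnion.2 ⟨x, mem_extChartAt_source x⟩
  refine ⟨t, SmoothPartitionOfUnity.exists_isSubordinate 𝓘(ℝ, E) isClosed_univ _
    (fun i => isOpen_extChartAt_source _) fun x hx => ?_⟩
  obtain ⟨i, hi, hxi⟩ := Set.mem_iUnion₂.1 (ht hx)
  exact Set.mem_iUnion.2 ⟨⟨i, hi⟩, hxi⟩

section FormIntegral

variable {ι : Type*} [Fintype ι] {c : ι → M} (f : SmoothPartitionOfUnity ι 𝓘(ℝ, E) M)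

theorem sum_funSMul_partition (σ : FormField E M k) : ∑ i, σ.funSMul (f i) = σ := by
  funext x
  have hf : ∑ i, f i x = 1 := by
    rw [← finsum_eq_sum_of_fintype]
    exact f.sum_eq_one (Set.mem_univ x)
  calc (∑ i, σ.funSMul (f i)) x = ∑ i, f i x • σ x := Finset.sum_apply _ _ _
    _ = σ x := by rw [← Finset.sum_smul, hf, one_smul]

/-- The integral over `M` of the top form `α`, for the orientation in which the volume form `σ` is
positive, computed with a finite partition of unity `f` subordinate to the charts at the
points `c i`. -/
def formIntegral [MeasurableSpace E] (μ : Measure E) (e : Module.Basis (Fin N) ℝ E)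
    (σ : FormField E M N) (c : ι → M) (α : FormField E M N) : ℝ :=
  ∑ i, chartIntegral μ e σ (c i) (α.funSMul (f i))

variable [IsManifold 𝓘(ℝ, E) ∞ M] [CompactSpace M] [MeasurableSpace E] [BorelSpace E]
  (μ : Measure E) (e : Module.Basis (Fin N) ℝ E) {σ : FormField E M N}
  (hf : f.IsSubordinate fun i => (extChartAt 𝓘(ℝ, E) (c i)).source)
include hf

theorem formIntegral_sum [IsFiniteMeasureOnCompacts μ] (hσ : IsVolumeForm σ) {κ : Type*}
    (s : Finset κ) {α : κ → FormField E M N} (hα : ∀ j, IsSmoothForm (α j)) :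
    formIntegral f μ e σ c (∑ j ∈ s, α j) = ∑ j ∈ s, formIntegral f μ e σ c (α j) := by
  simp_rw [formIntegral, FormField.funSMul_sum]
  rw [Finset.sum_comm]
  exact Finset.sum_congr rfl fun i _ => chartIntegral_sum μ e hσ s
    (fun j => (hα j).funSMul (f i).contMDiff) fun j => FormField.supportedInChart_funSMul (hf i) _

theorem formIntegral_self_pos [IsFiniteMeasureOnCompacts μ] [μ.IsOpenPosMeasure] [Nonempty M]
    (hσ : IsVolumeForm σ) : 0 < formIntegral f μ e σ c σ := by
  obtain ⟨x⟩ := ‹Nonempty M›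
  obtain ⟨i, hi⟩ := f.exists_pos_of_mem (Set.mem_univ x)
  exact Finset.sum_pos' (fun j _ => chartIntegral_funSMul_self_nonneg μ e σ (c j) (f.nonneg j))
    ⟨i, Finset.mem_univ i, chartIntegral_funSMul_self_pos μ e hσ (f i).contMDiff (f.nonneg i)
      (hf i) hi⟩

variable [FiniteDimensional ℝ E] [μ.IsAddHaarMeasure]

theorem formIntegral_eq_chartIntegral (hσ : IsVolumeForm σ) {α : FormField E M N}
    (hα : IsSmoothForm α) {x₀ : M} (hα₀ : α.SupportedInChart x₀) :
    formIntegral f μ e σ c α = chartIntegral μ e σ x₀ α := calc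
  formIntegral f μ e σ c α = ∑ i, chartIntegral μ e σ x₀ (α.funSMul (f i)) :=
    Finset.sum_congr rfl fun i _ => chartIntegral_congr_chart μ e σ
      (FormField.supportedInChart_funSMul (hf i) α) (hα₀.funSMul (f i))
  _ = chartIntegral μ e σ x₀ (∑ i, α.funSMul (f i)) :=
    (chartIntegral_sum μ e hσ _ (fun i => hα.funSMul (f i).contMDiff)
      fun i => hα₀.funSMul (f i)).symm
  _ = chartIntegral μ e σ x₀ α := by rw [sum_funSMul_partition]

theorem formIntegral_extDer_eq_zero (e : Module.Basis (Fin (d + 1)) ℝ E)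
    {σ : FormField E M (d + 1)} (hσ : IsVolumeForm σ) {β : FormField E M d}
    (hβ : IsSmoothForm β) : formIntegral f μ e σ c (extDer β) = 0 := by
  have hsmooth (i : ι) : IsSmoothForm (β.funSMul (f i)) := hβ.funSMul (f i).contMDiff
  rw [← sum_funSMul_partition f β, extDer_sum _ hsmooth,
    formIntegral_sum f μ e hf hσ _ fun i => (hsmooth i).extDer]
  refine Finset.sum_eq_zero fun i _ => ?_
  have hsupp := FormField.supportedInChart_funSMul (hf i) β
  rw [formIntegral_eq_chartIntegral f μ e hf hσ (hsmooth i).extDer hsupp.extDer]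
  exact chartIntegral_extDer_eq_zero μ e hσ (hsmooth i) hsupp

end FormIntegral

theorem exists_extDer_eq_zero [IsManifold 𝓘(ℝ, E) ∞ M] [T2Space M] [CompactSpace M] [Nonempty M]
    (hd : Module.finrank ℝ E = d + 1) {β : FormField E M d} (hβ : IsSmoothForm β) :
    ∃ x, extDer β x = 0 := by
  by_contra! hne
  have : FiniteDimensional ℝ E := .of_finrank_eq_succ hd
  borelize E
  obtain ⟨t, f, hf⟩ := exists_finite_subordinate_partition E M
  have hvol : IsVolumeForm (extDer β) := ⟨hβ.extDer, hne⟩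
  let e := Module.finBasisOfFinrankEq ℝ E hd
  exact (formIntegral_self_pos f Measure.addHaar e hf hvol).ne'
    (formIntegral_extDer_eq_zero f Measure.addHaar hf e hvol hβ)

end ExactTopForms

/-! ### Metric `f`-contact manifolds -/

section BasicForms

variable {E : Type*} [NormedAddCommGroup E] [NormedSpace ℝ E]
  {M : Type*} [TopologicalSpace M] [ChartedSpace E M] {k : ℕ}

theorem contractsToZero_iff {σ : FormField E M k} {X : VField E M} :
    ContractsToZero X σ ↔ ∀ x, X x ∈ radical (σ x) := by
  cases k with
  | zero => exact ⟨fun _ _ _ i => i.elim0, fun _ => trivial⟩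
  | succ k =>
    exact ⟨fun h x => mem_radical_of_forall_vecCons (h x),
      fun h x _ => map_eq_zero_of_mem_radical (i := 0) (h x)⟩

theorem chartForm_constOfIsEmpty (c : ℝ) (x₀ : M) : chartForm (k := 0)
    (fun _ : M => ContinuousAlternatingMap.constOfIsEmpty ℝ E (Fin 0) c) x₀ =
      fun _ => ContinuousAlternatingMap.constOfIsEmpty ℝ E (Fin 0) c :=
  rfl

theorem isSmoothForm_constOfIsEmpty (c : ℝ) : IsSmoothForm (E := E) (M := M) (k := 0)
    fun _ => ContinuousAlternatingMap.constOfIsEmpty ℝ E (Fin 0) c := by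
  intro x₀
  rw [chartForm_constOfIsEmpty]
  exact contDiffOn_const

variable [IsManifold 𝓘(ℝ, E) ∞ M]

theorem extDer_constOfIsEmpty (c : ℝ) : extDer (E := E) (M := M) (k := 0)
    (fun _ => ContinuousAlternatingMap.constOfIsEmpty ℝ E (Fin 0) c) = 0 :=
  funext fun x => by
    refine (extDer_eq_extDeriv _ x).trans ?_
    rw [chartForm_constOfIsEmpty, extDeriv, fderiv_fun_const]
    exact (ContinuousAlternatingMap.alternatizeUncurryFinCLM ℝ E ℝ).map_zero

theorem basicClass_ne_zero_iff {D : ∀ x : M, Submodule ℝ (TangentSpace 𝓘(ℝ, E) x)}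
    {σ : FormField E M k} {h : σ ∈ closedBasicForms D k} :
    basicClass D σ h ≠ 0 ↔ σ ∉ exactBasicForms D k :=
  (Submodule.Quotient.mk_eq_zero _).not

end BasicForms

namespace MetricFStructure

variable {E : Type*} [NormedAddCommGroup E] [NormedSpace ℝ E]
  {M : Type*} [TopologicalSpace M] [ChartedSpace E M] [IsManifold 𝓘(ℝ, E) ∞ M]
  {s p : ℕ} (S : MetricFStructure E M s)

theorem fundForm_apply (x : M) (v w : TangentSpace 𝓘(ℝ, E) x) :
    S.fundForm x ![v, w] = S.g.inner x v (S.f x w) :=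
  rfl

theorem ξ_mem_radical_fundForm (α : Fin s) (x : M) : S.ξ α x ∈ radical (S.fundForm x) :=
  mem_radical_two_iff.2 fun w => by rw [fundForm_apply, S.g.symm, S.inner_ξ, S.η_f]

theorem ξ_mem_radical_η {α β : Fin s} (h : α ≠ β) (x : M) : S.ξ β x ∈ radical (S.η α x) := by
  refine mem_radical_of_forall_vecCons fun v => ?_
  rw [Subsingleton.elim v ![], S.η_ξ, if_neg h]

theorem f_eq_zero_of_mem_radical_fundForm {x : M} {v : TangentSpace 𝓘(ℝ, E) x}
    (h : v ∈ radical (S.fundForm x)) : S.f x v = 0 := by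
  by_contra hne
  refine (S.g.pos x _ hne).ne' ?_
  rw [← fundForm_apply, map_pair_swap, mem_radical_two_iff.1 h, neg_zero]

theorem radical_fundForm (x : M) : radical (S.fundForm x) = S.charDistribution x := by
  refine le_antisymm (fun v hv => ?_) (Submodule.span_le.2 ?_)
  · have hsum : v = ∑ α, S.η α x ![v] • S.ξ α x := by
      rw [← neg_add_eq_zero, ← S.f_sq, S.f_eq_zero_of_mem_radical_fundForm hv, map_zero]
    rw [hsum]
    exact sum_mem fun α _ => Submodule.smul_mem _ _ (Submodule.subset_span ⟨α, rfl⟩)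
  · rintro _ ⟨α, rfl⟩
    exact S.ξ_mem_radical_fundForm α x

theorem linearIndependent_ξ (x : M) : LinearIndependent ℝ fun α => S.ξ α x := by
  refine Fintype.linearIndependent_iff.2 fun c hc α => ?_
  calc c α = ∑ β, c β * S.g.inner x (S.ξ α x) (S.ξ β x) := by
        simp [S.inner_ξ, S.η_ξ, eq_comm]
    _ = S.g.inner x (S.ξ α x) (∑ β, c β • S.ξ β x) := by
        simp only [map_sum, map_smul, smul_eq_mul]
    _ = 0 := by rw [hc, map_zero]

theorem fundFormPow_apply_ne_zero [FiniteDimensional ℝ E] {n : ℕ}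
    (hd : Module.finrank ℝ E = 2 * n + s) (x : M) : S.fundFormPow n x ≠ 0 := by
  have : FiniteDimensional ℝ (TangentSpace 𝓘(ℝ, E) x) := ‹FiniteDimensional ℝ E›
  have hrank : Module.finrank ℝ (S.charDistribution x) = s := by
    rw [charDistribution, finrank_span_eq_card (S.linearIndependent_ξ x), Fintype.card_fin]
  refine wedgePow_ne_zero ?_
  rw [S.radical_fundForm, hrank]
  exact hd.ge

theorem eq_zero_of_ξ_mem_radical [FiniteDimensional ℝ E] {x : M} {A : Finset (Fin s)}
    {a : TangentSpace 𝓘(ℝ, E) x [⋀^Fin p]→L[ℝ] ℝ} (h : ∀ α ∈ A, S.ξ α x ∈ radical a)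
    (hd : Module.finrank ℝ E < p + A.card) : a = 0 := by
  have : FiniteDimensional ℝ (TangentSpace 𝓘(ℝ, E) x) := ‹FiniteDimensional ℝ E›
  have hindep : LinearIndependent ℝ fun α : A => S.ξ α x :=
    (S.linearIndependent_ξ x).comp _ Subtype.val_injective
  have hle : Submodule.span ℝ (Set.range fun α : A => S.ξ α x) ≤ radical a :=
    Submodule.span_le.2 (by rintro _ ⟨α, rfl⟩; exact h α α.2)
  have hrank := Submodule.finrank_mono hle
  rw [finrank_span_eq_card hindep, Fintype.card_coe] at hrank
  exact eq_zero_of_finrank_lt (hd.trans_le (Nat.add_le_add_left hrank p))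

theorem ξ_mem_radical_fundFormPow (k : ℕ) (α : Fin s) (x : M) :
    S.ξ α x ∈ radical (S.fundFormPow k x) :=
  radical_le_radical_wedgePow _ k (S.ξ_mem_radical_fundForm α x)

/-- Smooth forms `T` that are basic for the `ξ_α` with `α ∈ A`, i.e. both `T` and `dT` are
annihilated by contraction with these vector fields. -/
structure IsBasicAlong (A : Finset (Fin s)) (T : FormField E M p) : Prop where
  smooth : IsSmoothForm T
  ξ_mem_radical : ∀ α ∈ A, ∀ x, S.ξ α x ∈ radical (T x)
  ξ_mem_radical_extDer : ∀ α ∈ A, ∀ x, S.ξ α x ∈ radical (extDer T x)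

variable {S}

theorem eq_zero_of_wedge_η_eq_zero {x : M} {β : Fin s}
    {a : TangentSpace 𝓘(ℝ, E) x [⋀^Fin p]→L[ℝ] ℝ} (ha : S.ξ β x ∈ radical a)
    (h : wedge a (S.η β x) = 0) : a = 0 := by
  refine ContinuousAlternatingMap.ext fun v => ?_
  have hv := wedge_append a (S.η β x) v (w := ![S.ξ β x]) fun i => by fin_cases i; exact ha
  rw [h, S.η_ξ, if_pos rfl, mul_one] at hv
  exact hv.symm

theorem isBasicAlong_of_mem_basicForms {τ : FormField E M p} {A : Finset (Fin s)}
    (hτ : τ ∈ basicForms S.charDistribution p)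
    (hdτ : ∀ α ∈ A, ∀ x, S.ξ α x ∈ radical (extDer τ x)) : S.IsBasicAlong A τ :=
  ⟨hτ.1, fun α _ => contractsToZero_iff.1
    (hτ.2 (S.ξ α) ⟨S.smooth_ξ α, fun _ => Submodule.subset_span ⟨α, rfl⟩⟩).1, hdτ⟩

namespace IsContact

variable (hS : S.IsContact)
include hS

theorem isSmoothForm_fundForm : IsSmoothForm S.fundForm :=
  hS.2 ⟨0, hS.1⟩ ▸ (S.smooth_η _).extDer

theorem extDer_fundForm : extDer S.fundForm = 0 :=
  hS.2 ⟨0, hS.1⟩ ▸ extDer_extDer (S.smooth_η _)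

theorem isSmoothForm_fundFormPow (k : ℕ) : IsSmoothForm (S.fundFormPow k) := by
  induction k with
  | zero => exact isSmoothForm_constOfIsEmpty 1
  | succ k ih => exact ih.wedge hS.isSmoothForm_fundForm

theorem extDer_fundFormPow (k : ℕ) : extDer (S.fundFormPow k) = 0 := by
  induction k with
  | zero => exact extDer_constOfIsEmpty 1
  | succ k ih =>
    refine (extDer_wedge_two_of_closed (hS.isSmoothForm_fundFormPow k) hS.isSmoothForm_fundForm
      hS.extDer_fundForm).trans ?_
    rw [ih]
    exact funext fun x => wedge_zero_left _

theorem fundFormPow_mem_closedBasicForms [CompleteSpace E] (k : ℕ) :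
    S.fundFormPow k ∈ closedBasicForms S.charDistribution (2 * k) := by
  refine ⟨⟨hS.isSmoothForm_fundFormPow k, fun X hX => ?_⟩, hS.extDer_fundFormPow k⟩
  have hXk (x : M) : X x ∈ radical (S.fundFormPow k x) :=
    radical_le_radical_wedgePow _ k (S.radical_fundForm x ▸ hX.2 x)
  exact ⟨contractsToZero_iff.2 hXk,
    lieDer_eq_zero_of_closed (hS.isSmoothForm_fundFormPow k) (hS.extDer_fundFormPow k) hX.1 hXk⟩

theorem extDer_wedge_fundForm {T : FormField E M p} (hT : IsSmoothForm T) :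
    extDer (T.wedge S.fundForm) = (extDer T).wedge S.fundForm :=
  extDer_wedge_two_of_closed hT hS.isSmoothForm_fundForm hS.extDer_fundForm

theorem isBasicAlong_wedge_fundForm {A : Finset (Fin s)} {T : FormField E M p}
    (hT : S.IsBasicAlong A T) : S.IsBasicAlong A (T.wedge S.fundForm) where
  smooth := hT.smooth.wedge hS.isSmoothForm_fundForm
  ξ_mem_radical α hα x :=
    inf_radical_le_radical_wedge _ _ ⟨hT.ξ_mem_radical α hα x, S.ξ_mem_radical_fundForm α x⟩
  ξ_mem_radical_extDer α hα x := by
    rw [hS.extDer_wedge_fundForm hT.smooth]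
    exact inf_radical_le_radical_wedge _ _
      ⟨hT.ξ_mem_radical_extDer α hα x, S.ξ_mem_radical_fundForm α x⟩

theorem exists_primitive_fundFormPow {A : Finset (Fin s)} {k m : ℕ} (hkm : k ≤ m)
    {τ : FormField E M (2 * k + 1)} (hτ : S.IsBasicAlong A τ)
    (hdτ : extDer τ = S.fundFormPow (k + 1)) :
    ∃ τ' : FormField E M (2 * m + 1), S.IsBasicAlong A τ' ∧ extDer τ' = S.fundFormPow (m + 1) := by
  induction m, hkm using Nat.le_induction with
  | base => exact ⟨τ, hτ, hdτ⟩
  | succ m _ ih =>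
    obtain ⟨τ', hτ', hdτ'⟩ := ih
    refine ⟨τ'.wedge S.fundForm, hS.isBasicAlong_wedge_fundForm hτ',
      (hS.extDer_wedge_fundForm hτ'.smooth).trans ?_⟩
    rw [hdτ']
    rfl

theorem extDer_wedge_η [FiniteDimensional ℝ E] {A : Finset (Fin s)} {T : FormField E M p}
    (hT : S.IsBasicAlong A T) (hd : Module.finrank ℝ E < p + 2 + A.card) (β : Fin s) :
    extDer (T.wedge (S.η β)) = (extDer T).wedge (S.η β) := by
  have hTω : T.wedge S.fundForm = 0 := funext fun x => S.eq_zero_of_ξ_mem_radical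
    (fun α hα => inf_radical_le_radical_wedge _ _
      ⟨hT.ξ_mem_radical α hα x, S.ξ_mem_radical_fundForm α x⟩) hd
  rw [extDer_wedge_one hT.smooth (S.smooth_η β), hS.2 β, hTω, smul_zero]
  exact add_zero _

theorem isBasicAlong_wedge_η [FiniteDimensional ℝ E] {A : Finset (Fin s)} {β : Fin s}
    (hβ : β ∉ A) {T : FormField E M p} (hT : S.IsBasicAlong (A.cons β hβ) T)
    (hd : Module.finrank ℝ E < p + 2 + (A.cons β hβ).card) :
    S.IsBasicAlong A (T.wedge (S.η β)) where
  smooth := hT.smooth.wedge (S.smooth_η β)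
  ξ_mem_radical α hα x := inf_radical_le_radical_wedge _ _
    ⟨hT.ξ_mem_radical α (Finset.mem_cons_of_mem hα) x,
      S.ξ_mem_radical_η (ne_of_mem_of_not_mem hα hβ).symm x⟩
  ξ_mem_radical_extDer α hα x := by
    rw [hS.extDer_wedge_η hT hd]
    exact inf_radical_le_radical_wedge _ _
      ⟨hT.ξ_mem_radical_extDer α (Finset.mem_cons_of_mem hα) x,
        S.ξ_mem_radical_η (ne_of_mem_of_not_mem hα hβ).symm x⟩

theorem exists_extDer_eq_zero_of_isBasicAlong [T2Space M] [CompactSpace M] [Nonempty M]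
    [FiniteDimensional ℝ E] {A : Finset (Fin s)} {T : FormField E M p} (hT : S.IsBasicAlong A T)
    (hd : Module.finrank ℝ E = p + A.card + 1) : ∃ x, extDer T x = 0 := by
  induction A using Finset.cons_induction generalizing p with
  | empty => exact exists_extDer_eq_zero hd hT.smooth
  | cons β A hβ ih =>
    have hlt : Module.finrank ℝ E < p + 2 + (A.cons β hβ).card := by omega
    rw [Finset.card_cons] at hd
    obtain ⟨x, hx⟩ := ih (hS.isBasicAlong_wedge_η hβ hT hlt) (by omega)
    rw [hS.extDer_wedge_η hT hlt] at hx
    exact ⟨x, eq_zero_of_wedge_η_eq_zero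
      (hT.ξ_mem_radical_extDer β (Finset.mem_cons_self β A) x) hx⟩

theorem fundFormPow_notMem_exactBasicForms [T2Space M] [CompactSpace M] [Nonempty M] {n k : ℕ}
    (hd : Module.finrank ℝ E = 2 * n + s) (hk : k ≤ n) :
    S.fundFormPow k ∉ exactBasicForms S.charDistribution (2 * k) := by
  have : FiniteDimensional ℝ E := .of_finrank_pos (by have := hS.1; omega)
  cases k with
  | zero =>
    intro h
    obtain ⟨x⟩ := ‹Nonempty M›
    exact one_ne_zero (DFunLike.congr_fun (congrFun (show S.fundFormPow 0 = 0 from h) x) Fin.elim0)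
  | succ k =>
    rintro ⟨τ, hτ, hdτ⟩
    obtain ⟨m, rfl⟩ : ∃ m, n = m + 1 := Nat.exists_eq_add_one.2 (by omega)
    have hτ : S.IsBasicAlong Finset.univ τ := isBasicAlong_of_mem_basicForms hτ fun α _ x =>
      hdτ ▸ S.ξ_mem_radical_fundFormPow (k + 1) α x
    obtain ⟨τ', hτ', hdτ'⟩ := hS.exists_primitive_fundFormPow (Nat.le_of_succ_le_succ hk) hτ hdτ
    obtain ⟨x, hx⟩ := hS.exists_extDer_eq_zero_of_isBasicAlong hτ' (by
      rw [hd, Finset.card_univ, Fintype.card_fin]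
      ring)
    exact S.fundFormPow_apply_ne_zero hd x (hdτ' ▸ hx)

end IsContact

end MetricFStructure

end FKContact

end

theorem lemma6p3_general {n s : ℕ} {E : Type*} [NormedAddCommGroup E] [NormedSpace ℝ E]
    {M : Type*} [TopologicalSpace M] [T2Space M] [CompactSpace M] [Nonempty M] [ChartedSpace E M]
    [IsManifold 𝓘(ℝ, E) ∞ M] (S : FKContact.MetricFStructure E M s) (hS : S.IsContact)
    (hd : Module.finrank ℝ E = 2 * n + s) {k : ℕ} (hk : k ≤ n) :
    ∃ h : S.fundFormPow k ∈ FKContact.closedBasicForms S.charDistribution (2 * k),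
      FKContact.basicClass S.charDistribution (S.fundFormPow k) h ≠ 0 := by
  have : FiniteDimensional ℝ E := .of_finrank_pos (by have := hS.1; omega)
  have : CompleteSpace E := FiniteDimensional.complete ℝ E
  exact ⟨hS.fundFormPow_mem_closedBasicForms k,
    FKContact.basicClass_ne_zero_iff.2 (hS.fundFormPow_notMem_exactBasicForms hd hk)⟩

theorem lemma6p3 {n s : ℕ} {M : Type*} [TopologicalSpace M] [T2Space M] [CompactSpace M]
    [Nonempty M] [ChartedSpace (EuclideanSpace ℝ (Fin (2 * n + s))) M]
    [IsManifold 𝓘(ℝ, EuclideanSpace ℝ (Fin (2 * n + s))) ∞ M]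
    (S : FKContact.MetricFStructure (EuclideanSpace ℝ (Fin (2 * n + s))) M s)
    (hS : S.IsKContact) (k : ℕ) (hk : k ≤ n) :
    ∃ h : S.fundFormPow k ∈ FKContact.closedBasicForms S.charDistribution (2 * k),
      FKContact.basicClass S.charDistribution (S.fundFormPow k) h ≠ 0 :=
  lemma6p3_general S hS.1 (by simp) hk
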